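/- Let $f\in\mathbb{C}[x_0,\dots,x_n]$ ($n\ge 0$) be a homogeneous polynomial of degree $3$. The eigenscheme $E(f)\subset\mathbb{P}^n$ is the closed subscheme defined by the $2\times 2$ minors $x_i\frac{\partial f}{\partial x_j}-x_j\frac{\partial f}{\partial x_i}$ of the matrix with rows $(x_0,\dots,x_n)$ and $\left(\frac{\partial f}{\partial x_0},\dots,\frac{\partial f}{\partial x_n}\right)$. The irregular eigenscheme $\mathrm{Irr}(f)\subset\mathbb{P}^n$ is the closed subscheme defined by the ideal $\left(\frac{\partial f}{\partial x_0},\dots,\frac{\partial f}{\partial x_n}\right)$. The regular eigenscheme is $\mathrm{Reg}(f)=E(f)\setminus\mathrm{Irr}(f)$; its closure is the closed subscheme defined by the saturation $I(E(f)):I(\mathrm{Irr}(f))^{\infty}$. The closed points of $\mathrm{Reg}(f)$ are called the regular eigenpoints of $f$: they are the points at which the gradient map $\nabla f:\mathbb{P}^n\dashrightarrow\mathbb{P}^n$ is given by a nonzero gradient vector and which it fixes. If $\dim\mathrm{Reg}(f)\le 0$ (the empty scheme being allowed), then $f$ has at most $2^{n+1}-1$ regular eigenpoints. Moreover: 1.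 for every $t\in\{0,1,\dots,7\}$ there exists a nonzero ternary cubic $f\in\mathbb{C}[x_0,x_1,x_2]_3$ such that $\mathrm{Reg}(f)$ is reduced and consists of exactly $t$ points, all of them real (i.e. having real homogeneous coordinates); 2. for every $t\in\{0,1,\dots,15\}$ there exists a nonzero quaternary cubic $f\in\mathbb{C}[x_0,x_1,x_2,x_3]_3$ such that $\mathrm{Reg}(f)$ is reduced and consists of exactly $t$ points, all of them real. -/

import Mathlib

namespace CubicEigen

open MvPolynomial

attribute [local instance] MvPolynomial.gradedAlgebra

/-- The homogeneous ideal of the eigenscheme `E(f)`: it is generated by the `2 × 2` minors of the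
matrix with rows `(x_i)` and `(∂f/∂x_i)`. -/
noncomputable def eigenIdeal {m : ℕ} (f : MvPolynomial (Fin m) ℂ) :
    Ideal (MvPolynomial (Fin m) ℂ) :=
  Ideal.span {g | ∃ i j : Fin m, g = X i * pderiv j f - X j * pderiv i f}

/-- The homogeneous ideal of the irregular eigenscheme `Irr(f)`: it is generated by the partial
derivatives of `f`. -/
noncomputable def irregularIdeal {m : ℕ} (f : MvPolynomial (Fin m) ℂ) :
    Ideal (MvPolynomial (Fin m) ℂ) :=
  Ideal.span (Set.range fun i : Fin m => pderiv i f)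

/-- The saturation `J : I^∞` of the ideal `J` with respect to the ideal `I`. -/
def saturation {R : Type*} [CommRing R] (J I : Ideal R) : Ideal R where
  carrier := {g | ∃ k : ℕ, ∀ h ∈ I ^ k, g * h ∈ J}
  zero_mem' := ⟨0, fun h _ => by simp⟩
  add_mem' := by
    rintro a b ⟨k, hk⟩ ⟨l, hl⟩
    refine ⟨k + l, fun h hh => ?_⟩
    rw [add_mul]
    exact J.add_mem (hk h (Ideal.pow_le_pow_right (Nat.le_add_right k l) hh))
      (hl h (Ideal.pow_le_pow_right (Nat.le_add_left l k) hh))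
  smul_mem' := by
    rintro c a ⟨k, hk⟩
    refine ⟨k, fun h hh => ?_⟩
    rw [smul_eq_mul, mul_assoc]
    exact J.mul_mem_left c (hk h hh)

/-- The ideal of the regular eigenscheme `Reg(f) = E(f) \ Irr(f)`, i.e. the saturated homogeneous
ideal of its scheme-theoretic closure in projective space: the saturation of the ideal of `E(f)`
with respect to the ideal of `Irr(f)`. -/
noncomputable def regularIdeal {m : ℕ} (f : MvPolynomial (Fin m) ℂ) :
    Ideal (MvPolynomial (Fin m) ℂ) :=
  saturation (eigenIdeal f) (irregularIdeal f)

/-- The underlying topological space of the regular eigenscheme `Reg(f) = E(f) \ Irr(f)`, as a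
locally closed subspace of `Proj ℂ[x_0, …, x_{m-1}]`. -/
def regularSpace {m : ℕ} (f : MvPolynomial (Fin m) ℂ) :
    Set (ProjectiveSpectrum (homogeneousSubmodule (Fin m) ℂ)) :=
  ProjectiveSpectrum.zeroLocus (homogeneousSubmodule (Fin m) ℂ) (eigenIdeal f) \
    ProjectiveSpectrum.zeroLocus (homogeneousSubmodule (Fin m) ℂ) (irregularIdeal f)

/-- The dimension of the regular eigenscheme (it is `⊥` if `Reg(f)` is empty). -/
noncomputable def regularDim {m : ℕ} (f : MvPolynomial (Fin m) ℂ) : WithBot ℕ∞ :=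
  topologicalKrullDim (regularSpace f)

/-- `Reg(f)` is reduced: the saturated homogeneous ideal that defines it is radical. -/
def IsRegReduced {m : ℕ} (f : MvPolynomial (Fin m) ℂ) : Prop :=
  (regularIdeal f).IsRadical

/-- The closed points of the subscheme of `ℙ^{m-1}` defined by a homogeneous ideal `I` (for such `I`
the condition does not depend on the chosen representative). -/
def projZeros {m : ℕ} (I : Ideal (MvPolynomial (Fin m) ℂ)) :
    Set (Projectivization ℂ (Fin m → ℂ)) :=
  {p | ∀ g ∈ I, eval p.rep g = 0}

/-- The regular eigenpoints of `f`, i.e. the closed points of `Reg(f) = E(f) \ Irr(f)`. -/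
def regularEigenpoints {m : ℕ} (f : MvPolynomial (Fin m) ℂ) :
    Set (Projectivization ℂ (Fin m → ℂ)) :=
  projZeros (eigenIdeal f) \ projZeros (irregularIdeal f)

/-- A point of complex projective space is real if it has real homogeneous coordinates. -/
def IsRealPoint {m : ℕ} (p : Projectivization ℂ (Fin m → ℂ)) : Prop :=
  ∃ (v : Fin m → ℝ) (hv : (fun i => (v i : ℂ)) ≠ 0),
    p = Projectivization.mk ℂ (fun i => (v i : ℂ)) hv

end CubicEigen

/-!
Let `F = ∇f` for a cubic form `f` in `m` variables. An eigenpoint with `F(v) = λ v` and `λ ≠ 0` has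
exactly one representative with `F(w) = w`, namely `w = λ⁻¹ v`. So the regular eigenpoints of `f`
correspond to the nonzero vectors fixed by `F` (`encard_gradFixed`), that is, to the nonzero
solutions of a system of `m` affine quadrics in `m` unknowns, of which the origin is one more
solution.

*The bound.* If `Reg(f)` has dimension at most zero, it is finite, because it is a Noetherian `T₀`
space all of whose irreducible closed sets are maximal. The system then has finitely many solutions,
and at most `2 ^ m` of them by Bézout (`ncard_zeroLocus_span_le`). The inequality needed has a short
proof. Let `I` be the ideal of the system, let `A` be the polynomial ring, and let `A_{≤ c}` be the
polynomials of degree at most `c`. By the Nullstellensatz `A = A_{≤ c} + I` for some `c`; hence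
`A = A_{≤ c + 2k} + I ^ (k + 1)` for all `k`. Since `I ^ (k + 1)` lies in the `(k + 1)`-st power of
the maximal ideal of each solution, the Chinese remainder theorem shows that `A_{≤ c + 2k}` surjects
onto the product of the spaces of `k`-jets at the solutions. Comparing dimensions for large `k`
gives the bound.

*Reducedness.* If the Jacobian matrix of `F(w) - w` is invertible at all fixed vectors, they form a
reduced scheme (`isRadical_span_of_jacobian`). On the part of `E(f)` where `F_i ≠ 0`, the map
`x ↦ (x_i / F_i) x` takes values in this scheme, and pulling functions back along it shows that
`Reg(f)` is reduced (`isRegReduced_of_isRadical`).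

*The examples.* It remains to find cubics with `s = t + 1` fixed vectors, all real and
nondegenerate. For sums of cubics in disjoint sets of variables the numbers `s` multiply
(`HasRealFixed.orthoSum`). Together with `0` and `x³/3` in one variable, few cubics are needed: one
for `s = 3` in two variables, for `s = 5, 7` in three, and for `s = 11, 13, 15` in four. They are of
the form `z³/3 + z²t + x² ℓ(z, t) + y² ℓ'(z, t)` with linear forms `ℓ`, `ℓ'`, for which the fixed
vectors have rational `z`, `t`, `x²` and `y²`. The case `t = 0` is that of the cube of an isotropic
linear form.
-/

namespace CubicEigen

open MvPolynomial

attribute [local instance] MvPolynomial.gradedAlgebra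

/-! ### Points of polynomial rings -/

/-- The maximal ideal of the polynomials that vanish at the point `p`. -/
noncomputable def pointIdeal {σ K : Type*} [Field K] (p : σ → K) : Ideal (MvPolynomial σ K) :=
  RingHom.ker (eval p)

theorem mem_pointIdeal {σ K : Type*} [Field K] {p : σ → K} {g : MvPolynomial σ K} :
    g ∈ pointIdeal p ↔ eval p g = 0 := RingHom.mem_ker

instance pointIdeal_isMaximal {σ K : Type*} [Field K] (p : σ → K) : (pointIdeal p).IsMaximal :=
  RingHom.ker_isMaximal_of_surjective _ fun z => ⟨C z, by simp⟩

theorem X_sub_C_mem_pointIdeal {σ K : Type*} [Field K] (p : σ → K) (i : σ) :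
    X i - C (p i) ∈ pointIdeal p := by simp [mem_pointIdeal]

theorem pointIdeal_injective {σ K : Type*} [Field K] :
    Function.Injective (pointIdeal : (σ → K) → Ideal (MvPolynomial σ K)) := by
  intro p q h
  funext i
  have := h ▸ X_sub_C_mem_pointIdeal p i
  rw [mem_pointIdeal] at this
  simpa [sub_eq_zero, eq_comm] using this

theorem isCoprime_pointIdeal_pow {σ K : Type*} [Field K] {p q : σ → K} (h : p ≠ q) (k : ℕ) :
    IsCoprime (pointIdeal p ^ k) (pointIdeal q ^ k) :=
  (Ideal.isCoprime_of_isMaximal (pointIdeal_injective.ne h)).pow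

/-- The translation that moves the point `p` to the origin carries `pointIdeal p` into the ideal of
the variables. -/
theorem aeval_mem_idealOfVars_pow {σ K : Type*} [Field K] (p : σ → K) {k : ℕ}
    {g : MvPolynomial σ K} (hg : g ∈ pointIdeal p ^ k) :
    aeval (fun i => X i + C (p i)) g ∈ idealOfVars σ K ^ k := by
  have hle : (pointIdeal p).map (aeval fun i => X i + C (p i) : MvPolynomial σ K →ₐ[K] _) ≤
      idealOfVars σ K := by
    rw [Ideal.map_le_iff_le_comap]
    intro g hg
    rw [Ideal.mem_comap, ← pow_one (idealOfVars σ K), mem_pow_idealOfVars_iff']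
    intro x hx
    obtain rfl : x = 0 := by simpa [Finsupp.degree_eq_zero_iff] using hx
    rw [mem_pointIdeal] at hg
    rw [← constantCoeff_eq, ← hg]
    have : constantCoeff.comp (aeval fun i => X i + C (p i) : MvPolynomial σ K →ₐ[K] _).toRingHom
        = eval p := by
      ext i <;> simp
    exact congrArg (fun φ : MvPolynomial σ K →+* K => φ g) this
  have := Ideal.pow_right_mono hle k
  rw [← Ideal.map_pow] at this
  exact this (Ideal.mem_map_of_mem _ hg)

/-- A nonzero polynomial of degree less than `k` does not vanish to order `k` at any point. -/
theorem eq_zero_of_mem_pointIdeal_pow {σ K : Type*} [Field K] (p : σ → K) {k : ℕ}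
    {g : MvPolynomial σ K} (hg : g ∈ pointIdeal p ^ (k + 1)) (hd : g.totalDegree ≤ k) : g = 0 := by
  set τ : MvPolynomial σ K →ₐ[K] MvPolynomial σ K := aeval fun i => X i + C (p i) with hτ
  have h1 := aeval_mem_idealOfVars_pow p hg
  have hdeg : (τ g).totalDegree ≤ k := by
    rw [hτ, aeval_eq_bind₁]
    refine le_trans ?_ hd
    rw [← aeval_eq_bind₁, aeval_def, eval₂_eq]
    refine totalDegree_finsetSum_le fun d hd => ?_
    refine (totalDegree_mul _ _).trans ?_
    have : (algebraMap K (MvPolynomial σ K) (coeff d g)).totalDegree = 0 := by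
      simp [algebraMap_eq]
    rw [this, zero_add]
    refine (totalDegree_finsetProd _ _).trans ?_
    refine le_trans (Finset.sum_le_sum fun i _ => ?_) (le_totalDegree hd)
    refine (totalDegree_pow _ _).trans ?_
    have : (X i + C (p i) : MvPolynomial σ K).totalDegree ≤ 1 :=
      (totalDegree_add _ _).trans (by simp)
    nlinarith
  have h0 : τ g = 0 := by
    ext x
    rw [coeff_zero]
    by_cases hx : x.degree < k + 1
    · exact (mem_pow_idealOfVars_iff' _ _).1 h1 x hx
    · by_contra hne
      have := le_totalDegree (mem_support_iff.2 hne)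
      rw [Finsupp.degree_apply] at hx
      exact hx (Nat.lt_succ_of_le (this.trans hdeg))
  have hinv : (aeval fun i => X i - C (p i) : MvPolynomial σ K →ₐ[K] _).comp τ = AlgHom.id K _ := by
    ext i; simp [hτ]
  have := congrArg (fun φ : MvPolynomial σ K →ₐ[K] _ => φ g) hinv
  simpa [h0] using this.symm

/-! ### A Bézout bound -/

/-- If the zero set of `I` is finite, the quotient by `I` is finite-dimensional, so every polynomial
is congruent modulo `I` to one of bounded degree. -/
theorem exists_degree_bound_of_finite_zeroLocus {σ K : Type*} [Finite σ] [Field K] [IsAlgClosed K]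
    (I : Ideal (MvPolynomial σ K)) (hI : (zeroLocus K I).Finite) :
    ∃ c : ℕ, ∀ p : MvPolynomial σ K, ∃ q : MvPolynomial σ K, q.totalDegree ≤ c ∧ p - q ∈ I := by
  have hint : ∀ i, IsIntegral K (Ideal.Quotient.mkₐ K I (X i)) := by
    intro i
    -- A monic polynomial in the `i`-th variable that vanishes at all points of the zero set.
    let P : Polynomial K := ∏ x ∈ hI.toFinset, (Polynomial.X - Polynomial.C (x i))
    have hP : P.Monic := Polynomial.monic_prod_of_monic _ _ fun x _ => Polynomial.monic_X_sub_C _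
    have hmem : Polynomial.aeval (X i : MvPolynomial σ K) P ∈ I.radical := by
      rw [← vanishingIdeal_zeroLocus_eq_radical (K := K)]
      intro x hx
      simp only [P, map_prod, map_sub, Polynomial.aeval_X, Polynomial.aeval_C]
      exact Finset.prod_eq_zero (hI.mem_toFinset.2 hx) (by simp)
    obtain ⟨r, hr⟩ := hmem
    refine ⟨P ^ r, hP.pow r, ?_⟩
    rw [← Polynomial.aeval_def, Polynomial.aeval_algHom_apply, map_pow]
    exact Ideal.Quotient.eq_zero_iff_mem.2 hr
  have hI' : Algebra.IsIntegral K (MvPolynomial σ K ⧸ I) := by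
    refine ⟨fun y => ?_⟩
    obtain ⟨p, rfl⟩ := Ideal.Quotient.mkₐ_surjective K I y
    induction p using MvPolynomial.induction_on with
    | C a => exact isIntegral_algebraMap
    | add p q hp hq => rw [map_add]; exact hp.add hq
    | mul_X p i hp => rw [map_mul]; exact hp.mul (hint i)
  have hfin : Module.Finite K (MvPolynomial σ K ⧸ I) := Algebra.IsIntegral.finite
  obtain ⟨n, s, hs⟩ := hfin.exists_fin
  choose t ht using fun j => Ideal.Quotient.mkₐ_surjective K I (s j)
  refine ⟨Finset.univ.sup fun j => (t j).totalDegree, fun p => ?_⟩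
  have hp : Ideal.Quotient.mkₐ K I p ∈ Submodule.span K (Set.range s) := hs ▸ Submodule.mem_top
  obtain ⟨a, ha⟩ := (Submodule.mem_span_range_iff_exists_fun K).1 hp
  refine ⟨∑ j, a j • t j, ?_, ?_⟩
  · refine totalDegree_finsetSum_le fun j hj => (totalDegree_smul_le _ _).trans ?_
    exact Finset.le_sup (f := fun j => (t j).totalDegree) hj
  · rw [← Ideal.Quotient.eq_zero_iff_mem]
    change Ideal.Quotient.mkₐ K I (p - _) = 0
    rw [map_sub, map_sum, ← ha]
    simp only [map_smul, ht, sub_self]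

theorem exists_degree_bound_pow {σ ι K : Type*} [Fintype ι] [Field K]
    (g : ι → MvPolynomial σ K) {d c : ℕ} (hg : ∀ i, (g i).totalDegree ≤ d)
    (hc : ∀ p : MvPolynomial σ K, ∃ q : MvPolynomial σ K,
      q.totalDegree ≤ c ∧ p - q ∈ Ideal.span (Set.range g)) (k : ℕ) (p : MvPolynomial σ K) :
    ∃ q : MvPolynomial σ K, q.totalDegree ≤ c + d * k ∧
      p - q ∈ Ideal.span (Set.range g) ^ (k + 1) := by
  induction k generalizing p with
  | zero => simpa using hc p
  | succ k ih =>
    obtain ⟨q, hq, hpq⟩ := hc p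
    obtain ⟨a, ha⟩ := (Ideal.mem_span_range_iff_exists_fun).1 hpq
    choose b hb hab using fun i => ih (a i)
    refine ⟨q + ∑ i, b i * g i, ?_, ?_⟩
    · refine (totalDegree_add _ _).trans (max_le (hq.trans (by omega)) ?_)
      refine totalDegree_finsetSum_le fun i _ => (totalDegree_mul _ _).trans ?_
      have := hb i; have := hg i
      rw [mul_add]; omega
    · have : p - (q + ∑ i, b i * g i) = ∑ i, (a i - b i) * g i := by
        simp only [sub_mul, Finset.sum_sub_distrib, ha]; ring
      rw [this, pow_succ]
      exact Ideal.sum_mem _ fun i _ => Ideal.mul_mem_mul (hab i) (Ideal.subset_span ⟨i, rfl⟩)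

theorem finrank_restrictTotalDegree (σ K : Type*) [Fintype σ] [Field K] (k : ℕ) :
    Module.finrank K (restrictTotalDegree σ K k) = (k + Fintype.card σ).choose (Fintype.card σ) := by
  classical
  have hset : {n : σ →₀ ℕ | (n.sum fun _ e => e) ≤ k} =
      ((Finset.range (k + 1)).biUnion fun j => (Finset.univ : Finset σ).finsuppAntidiag j :
        Finset (σ →₀ ℕ)) := by
    ext n
    simp [Finset.mem_finsuppAntidiag, Finsupp.sum_fintype]
  rw [restrictTotalDegree, Module.finrank_eq_nat_card_basis (basisRestrictSupport K _), hset]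
  simp only [Finset.coe_sort_coe, Nat.card_eq_fintype_card, Fintype.card_coe]
  rw [Finset.card_biUnion]
  · simp only [Finset.card_finsuppAntidiag_nat_eq_multichoose, Finset.card_univ]
    rw [Nat.sum_range_multichoose, add_comm k, Nat.choose_symm_add]
  · intro i _ j _ hij
    rw [Function.onFun, Finset.disjoint_left]
    intro n hi hj
    rw [Finset.mem_finsuppAntidiag] at hi hj
    exact hij (hi.1.symm.trans hj.1)

/-- If `N * (k + 1) ^ m` is bounded by `(d * k + b) ^ m` for all `k`, then `N ≤ d ^ m`. -/
theorem le_pow_of_forall_mul_pow_le {N m d b : ℕ}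
    (h : ∀ k : ℕ, N * (k + 1) ^ m ≤ (b + d * k) ^ m) : N ≤ d ^ m := by
  have hlim : Filter.Tendsto (fun k : ℕ => ((b : ℝ) / ((k : ℝ) + 1) + d) ^ m) Filter.atTop
      (nhds ((0 + d) ^ m)) := by
    refine ((Filter.Tendsto.add ?_ tendsto_const_nhds).pow m)
    exact tendsto_const_nhds.div_atTop
      (Filter.tendsto_atTop_add_const_right _ _ tendsto_natCast_atTop_atTop)
  have hle : (N : ℝ) ≤ (0 + d) ^ m := by
    refine ge_of_tendsto' hlim fun k => ?_
    have hk : (0 : ℝ) < (k : ℝ) + 1 := by positivity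
    have h' : (N : ℝ) * ((k : ℝ) + 1) ^ m ≤ (b + d * k) ^ m := by exact_mod_cast h k
    rw [← le_div_iff₀ (by positivity), ← div_pow] at h'
    refine h'.trans (pow_le_pow_left₀ (by positivity) ?_ m)
    rw [div_add' _ _ _ hk.ne']
    gcongr
    nlinarith [(Nat.cast_nonneg d : (0 : ℝ) ≤ d)]
  rw [zero_add] at hle
  exact_mod_cast hle

/-- **Bézout bound.** A system of `m` polynomial equations of degree at most `d` in `m` unknowns
with finitely many solutions has at most `d ^ m` solutions. Polynomials of degree at most `c + d * k`
represent all classes modulo `I ^ (k + 1)`, where `I` is the ideal of the system; in particular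
they represent all families of `k`-jets at the solutions. The bound follows by comparing
dimensions as `k` tends to infinity. -/
theorem ncard_zeroLocus_span_le {σ K : Type*} [Fintype σ] [Field K] [IsAlgClosed K]
    (g : σ → MvPolynomial σ K) {d : ℕ} (hg : ∀ i, (g i).totalDegree ≤ d)
    (hfin : (zeroLocus K (Ideal.span (Set.range g))).Finite) :
    (zeroLocus K (Ideal.span (Set.range g))).ncard ≤ d ^ Fintype.card σ := by
  classical
  obtain ⟨c, hc⟩ := exists_degree_bound_of_finite_zeroLocus _ hfin
  set m := Fintype.card σ
  set S := hfin.toFinset with hS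
  rw [Set.ncard_eq_toFinset_card _ hfin, ← hS]
  refine le_pow_of_forall_mul_pow_le (b := c + m) fun k => ?_
  let J : S → Ideal (MvPolynomial σ K) := fun p => pointIdeal p.1 ^ (k + 1)
  have hJ : Pairwise (Function.onFun IsCoprime J) := fun p q hpq =>
    isCoprime_pointIdeal_pow (fun h => hpq (Subtype.ext h)) _
  have hIJ : ∀ p, Ideal.span (Set.range g) ^ (k + 1) ≤ J p := by
    intro p
    refine Ideal.pow_right_mono (fun f hf => ?_) _
    rw [mem_pointIdeal, ← aeval_eq_eval]
    exact (hfin.mem_toFinset.1 p.2) f hf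
  let Ψ : restrictTotalDegree σ K (c + d * k) →ₗ[K] (∀ p, MvPolynomial σ K ⧸ J p) :=
    (LinearMap.pi fun p => (Ideal.Quotient.mkₐ K (J p)).toLinearMap) ∘ₗ Submodule.subtype _
  have hΨ : Function.Surjective Ψ := by
    intro x
    obtain ⟨r, hr⟩ := Ideal.pi_quotient_surjective hJ x
    obtain ⟨q, hq, hrq⟩ := exists_degree_bound_pow g hg hc k r
    refine ⟨⟨q, (mem_restrictTotalDegree _ _ _).2 hq⟩, ?_⟩
    funext p
    rw [← hr p]
    exact (Ideal.Quotient.eq.2 (hIJ p hrq)).symm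
  have hfinite : Module.Finite K (∀ p, MvPolynomial σ K ⧸ J p) := Module.Finite.of_surjective Ψ hΨ
  let Θ : (S → restrictTotalDegree σ K k) →ₗ[K] (∀ p, MvPolynomial σ K ⧸ J p) :=
    LinearMap.pi fun p =>
      ((Ideal.Quotient.mkₐ K (J p)).toLinearMap ∘ₗ Submodule.subtype _) ∘ₗ LinearMap.proj p
  have hΘ : Function.Injective Θ := by
    rw [← LinearMap.ker_eq_bot, LinearMap.ker_eq_bot']
    intro v hv
    funext p
    have hp : Ideal.Quotient.mk (J p) (v p).1 = 0 := congrFun hv p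
    exact Subtype.ext (eq_zero_of_mem_pointIdeal_pow p.1 (Ideal.Quotient.eq_zero_iff_mem.1 hp)
      ((mem_restrictTotalDegree _ _ _).1 (v p).2))
  have h1 := (LinearMap.finrank_le_finrank_of_injective hΘ).trans
    (LinearMap.finrank_le_finrank_of_surjective hΨ)
  rw [Module.finrank_pi_fintype, finrank_restrictTotalDegree] at h1
  simp only [finrank_restrictTotalDegree, Finset.sum_const, Finset.card_univ, Fintype.card_coe,
    smul_eq_mul] at h1
  calc S.card * (k + 1) ^ m ≤ S.card * (k + 1).ascFactorial m := by
        gcongr; exact Nat.pow_succ_le_ascFactorial _ _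
    _ = m.factorial * (S.card * (k + m).choose m) := by
        rw [Nat.ascFactorial_eq_factorial_mul_choose]; ring
    _ ≤ m.factorial * (c + d * k + m).choose m := by gcongr
    _ = (c + d * k + 1).ascFactorial m := by rw [Nat.ascFactorial_eq_factorial_mul_choose]
    _ ≤ (c + d * k + m) ^ m := Nat.ascFactorial_le_pow_add _ _
    _ = (c + m + d * k) ^ m := by ring

/-! ### Spaces of dimension zero -/

/-- A Noetherian `T₀` space of dimension at most zero is finite: its points correspond to its
irreducible components. -/
theorem finite_of_topologicalKrullDim_nonpos {T : Type*} [TopologicalSpace T]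
    [TopologicalSpace.NoetherianSpace T] [T0Space T] (h : topologicalKrullDim T ≤ 0) :
    Finite T := by
  have hmax := Order.krullDim_nonpos_iff_forall_isMax.1 h
  have hcl : ∀ x : T, closure {x} = irreducibleComponent x := by
    intro x
    let Z : TopologicalSpace.IrreducibleCloseds T :=
      ⟨closure {x}, isIrreducible_singleton.closure, isClosed_closure⟩
    let Y : TopologicalSpace.IrreducibleCloseds T :=
      ⟨irreducibleComponent x, isIrreducible_irreducibleComponent, isClosed_irreducibleComponent⟩
    have hZY : Z ≤ Y := isClosed_irreducibleComponent.closure_subset_iff.2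
      (Set.singleton_subset_iff.2 mem_irreducibleComponent)
    exact Set.Subset.antisymm hZY (hmax Z hZY)
  have hfin : Finite (irreducibleComponents T) :=
    TopologicalSpace.NoetherianSpace.finite_irreducibleComponents
  refine Finite.of_injective
    (fun x : T => (⟨irreducibleComponent x, irreducibleComponent_mem_irreducibleComponents x⟩ :
      irreducibleComponents T)) fun x y hxy => ?_
  have hxy' : closure {x} = closure {y} := by
    rw [hcl, hcl]; exact congrArg Subtype.val hxy
  exact (inseparable_iff_closure_eq.2 hxy').eq

instance projectiveSpectrum_t0Space {A σ : Type*} [CommRing A] [SetLike σ A]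
    [AddSubmonoidClass σ A] (𝒜 : ℕ → σ) [GradedRing 𝒜] : T0Space (ProjectiveSpectrum 𝒜) := by
  refine ⟨fun x y hxy => ?_⟩
  rw [inseparable_iff_mem_closure, ← ProjectiveSpectrum.le_iff_mem_closure,
    ← ProjectiveSpectrum.le_iff_mem_closure] at hxy
  exact le_antisymm hxy.2 hxy.1

instance projectiveSpectrum_noetherianSpace {A σ : Type*} [CommRing A] [IsNoetherianRing A]
    [SetLike σ A] [AddSubmonoidClass σ A] (𝒜 : ℕ → σ) [GradedRing 𝒜] :
    TopologicalSpace.NoetherianSpace (ProjectiveSpectrum 𝒜) := by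
  refine ((TopologicalSpace.noetherianSpace_TFAE _).out 0 1).2 ?_
  let φ : TopologicalSpace.Closeds (ProjectiveSpectrum 𝒜) → Ideal A := fun Z =>
    (ProjectiveSpectrum.vanishingIdeal (Z : Set (ProjectiveSpectrum 𝒜))).toIdeal
  have hφ : ∀ Z W, φ W ≤ φ Z → Z ≤ W := by
    intro Z W h x hx
    have hW := ProjectiveSpectrum.zeroLocus_vanishingIdeal_eq_closure 𝒜 (W : Set _)
    rw [W.isClosed.closure_eq] at hW
    change x ∈ (W : Set (ProjectiveSpectrum 𝒜))
    rw [← hW]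
    exact fun g hg => (ProjectiveSpectrum.mem_vanishingIdeal _ _).1 (h hg) x hx
  have hanti : StrictAnti φ := by
    intro Z W h
    refine lt_of_le_not_ge ?_ fun h' => h.not_ge (hφ _ _ h')
    exact ProjectiveSpectrum.vanishingIdeal_anti_mono _ h.le
  exact hanti.wellFoundedLT

/-! ### Regular eigenpoints and fixed vectors of the gradient -/

/-- The vectors `w` with `∇f(w) = w`. -/
def gradFixed {m : ℕ} (f : MvPolynomial (Fin m) ℂ) : Set (Fin m → ℂ) :=
  {w | ∀ i, eval w (pderiv i f) = w i}

theorem aeval_mul_of_isHomogeneous {σ R S : Type*} [CommSemiring R] [CommSemiring S] [Algebra R S]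
    {g : MvPolynomial σ R} {d : ℕ} (hg : g.IsHomogeneous d) (c : S) (v : σ → S) :
    aeval (fun i => c * v i) g = c ^ d * aeval v g := by
  rw [aeval_def, eval₂_eq, aeval_def, eval₂_eq, Finset.mul_sum]
  refine Finset.sum_congr rfl fun e he => ?_
  have : ∏ i ∈ e.support, c ^ e i = c ^ d := by
    rw [Finset.prod_pow_eq_pow_sum, ← hg (mem_support_iff.1 he), Finsupp.weight_apply]
    simp [Finsupp.sum]
  simp only [mul_pow, Finset.prod_mul_distrib, this]
  ring

theorem eval_smul_of_isHomogeneous {σ : Type*} {g : MvPolynomial σ ℂ} {d : ℕ}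
    (hg : g.IsHomogeneous d) (c : ℂ) (v : σ → ℂ) : eval (c • v) g = c ^ d * eval v g := by
  have := aeval_mul_of_isHomogeneous hg c v
  rwa [aeval_eq_eval] at this

theorem eval_eq_zero_of_mem_span {σ : Type*} {s : Set (MvPolynomial σ ℂ)} {v : σ → ℂ} :
    (∀ g ∈ Ideal.span s, eval v g = 0) ↔ ∀ g ∈ s, eval v g = 0 := by
  have : Ideal.span s ≤ pointIdeal v ↔ s ⊆ pointIdeal v := Ideal.span_le
  exact this

theorem mem_regularEigenpoints_iff {m : ℕ} {f : MvPolynomial (Fin m) ℂ}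
    {p : Projectivization ℂ (Fin m → ℂ)} :
    p ∈ regularEigenpoints f ↔
      (∀ i j, p.rep i * eval p.rep (pderiv j f) = p.rep j * eval p.rep (pderiv i f)) ∧
        ∃ i, eval p.rep (pderiv i f) ≠ 0 := by
  rw [regularEigenpoints, Set.mem_sdiff]
  simp only [projZeros, Set.mem_ofPred_eq, eigenIdeal, irregularIdeal, eval_eq_zero_of_mem_span]
  refine and_congr ⟨fun h i j => ?_, ?_⟩ ?_
  · simpa [sub_eq_zero] using h _ ⟨i, j, rfl⟩
  · rintro h _ ⟨i, j, rfl⟩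
    simpa [sub_eq_zero] using h i j
  · simp

theorem mk_mem_regularEigenpoints {m : ℕ} {f : MvPolynomial (Fin m) ℂ} (hf : f.IsHomogeneous 3)
    {w : Fin m → ℂ} (hw : w ∈ gradFixed f) (h0 : w ≠ 0) :
    Projectivization.mk ℂ w h0 ∈ regularEigenpoints f := by
  obtain ⟨a, ha⟩ := Projectivization.exists_smul_eq_mk_rep ℂ w h0
  have ha' : (Projectivization.mk ℂ w h0).rep = (a : ℂ) • w := ha.symm
  rw [mem_regularEigenpoints_iff, ha']
  have hF : ∀ i, eval ((a : ℂ) • w) (pderiv i f) = (a : ℂ) ^ 2 * w i := fun i => by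
    rw [eval_smul_of_isHomogeneous hf.pderiv, hw i]
  simp only [hF, Pi.smul_apply, smul_eq_mul]
  refine ⟨fun i j => by ring, ?_⟩
  obtain ⟨i, hi⟩ := Function.ne_iff.1 h0
  exact ⟨i, mul_ne_zero (pow_ne_zero _ a.ne_zero) hi⟩

/-- If `∇f(v) = λ v` with `λ ≠ 0`, then `λ⁻¹ v` is a fixed vector of the gradient. -/
theorem exists_gradFixed_of_mem_regularEigenpoints {m : ℕ} {f : MvPolynomial (Fin m) ℂ}
    (hf : f.IsHomogeneous 3) {p : Projectivization ℂ (Fin m → ℂ)}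
    (hp : p ∈ regularEigenpoints f) :
    ∃ (w : Fin m → ℂ) (h0 : w ≠ 0), w ∈ gradFixed f ∧ Projectivization.mk ℂ w h0 = p := by
  obtain ⟨h, i, hi⟩ := mem_regularEigenpoints_iff.1 hp
  -- The eigenvalue is `∂f/∂x_i (v) / v_i`; its numerator and denominator are nonzero.
  have hvi : p.rep i ≠ 0 := by
    intro h0
    refine p.rep_nonzero (funext fun j => ?_)
    have := h i j
    rw [h0, zero_mul] at this
    exact (mul_eq_zero.1 this.symm).resolve_right hi
  have hc : p.rep i / eval p.rep (pderiv i f) ≠ 0 := div_ne_zero hvi hi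
  refine ⟨(p.rep i / eval p.rep (pderiv i f)) • p.rep, smul_ne_zero hc p.rep_nonzero,
    fun j => ?_, ?_⟩
  · rw [eval_smul_of_isHomogeneous hf.pderiv, Pi.smul_apply, smul_eq_mul]
    have := h i j
    simp only [Nat.add_one_sub_one]
    field_simp
    linear_combination this
  · conv_rhs => rw [← p.mk_rep]
    exact (Projectivization.mk_eq_mk_iff' _ _ _ _ _).2 ⟨_, rfl⟩

theorem eq_of_mk_eq_mk {m : ℕ} {f : MvPolynomial (Fin m) ℂ} (hf : f.IsHomogeneous 3)
    {v w : Fin m → ℂ} (hv : v ∈ gradFixed f) (hw : w ∈ gradFixed f) (hv0 : v ≠ 0) (hw0 : w ≠ 0)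
    (h : Projectivization.mk ℂ v hv0 = Projectivization.mk ℂ w hw0) : v = w := by
  obtain ⟨a, rfl⟩ := (Projectivization.mk_eq_mk_iff' _ _ _ _ _).1 h
  obtain ⟨i, hi⟩ := Function.ne_iff.1 hw0
  have h1 := hv i
  rw [eval_smul_of_isHomogeneous hf.pderiv, hw i, Pi.smul_apply, smul_eq_mul] at h1
  have ha : a ≠ 0 := fun h => hv0 (by rw [h, zero_smul])
  have h2 : a * w i ≠ 0 := mul_ne_zero ha hi
  have h3 : a = 1 := by
    have : (a - 1) * (a * w i) = 0 := by linear_combination h1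
    exact sub_eq_zero.1 ((mul_eq_zero.1 this).resolve_right h2)
  rw [h3, one_smul]

theorem encard_regularEigenpoints {m : ℕ} {f : MvPolynomial (Fin m) ℂ} (hf : f.IsHomogeneous 3) :
    (regularEigenpoints f).encard = (gradFixed f \ {0}).encard := by
  let φ : ↥(gradFixed f \ {0}) → Projectivization ℂ (Fin m → ℂ) :=
    fun w => Projectivization.mk ℂ w.1 w.2.2
  have hφ : Function.Injective φ := fun v w h =>
    Subtype.ext (eq_of_mk_eq_mk hf v.2.1 w.2.1 v.2.2 w.2.2 h)
  have hr : Set.range φ = regularEigenpoints f := by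
    ext p
    constructor
    · rintro ⟨w, rfl⟩
      exact mk_mem_regularEigenpoints hf w.2.1 w.2.2
    · intro hp
      obtain ⟨w, h0, hw, rfl⟩ := exists_gradFixed_of_mem_regularEigenpoints hf hp
      exact ⟨⟨w, hw, h0⟩, rfl⟩
  rw [← hr, ← Set.image_univ, hφ.encard_image, Set.encard_univ, ENat.card_coe_set_eq]

theorem zero_mem_gradFixed {m : ℕ} {f : MvPolynomial (Fin m) ℂ} (hf : f.IsHomogeneous 3) :
    (0 : Fin m → ℂ) ∈ gradFixed f := by
  intro i
  have := eval_smul_of_isHomogeneous (hf.pderiv (i := i)) 0 0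
  simpa using this

theorem encard_gradFixed {m : ℕ} {f : MvPolynomial (Fin m) ℂ} (hf : f.IsHomogeneous 3) :
    (gradFixed f).encard = (regularEigenpoints f).encard + 1 := by
  rw [encard_regularEigenpoints hf, Set.encard_sdiff_singleton_add_one (zero_mem_gradFixed hf)]

/-! ### The bound on the number of regular eigenpoints -/

/-- The closed point of `Proj` defined by a nonzero vector. -/
noncomputable def projPoint {m : ℕ} (v : Fin m → ℂ) (hv : v ≠ 0) :
    ProjectiveSpectrum (homogeneousSubmodule (Fin m) ℂ) where
  asHomogeneousIdeal := (pointIdeal v).homogeneousCore _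
  isPrime := (pointIdeal_isMaximal v).isPrime.homogeneousCore
  not_irrelevant_le h := by
    refine hv (funext fun i => ?_)
    have hX : (X i : MvPolynomial (Fin m) ℂ) ∈ homogeneousSubmodule (Fin m) ℂ 1 :=
      isHomogeneous_X _ i
    have := Ideal.toIdeal_homogeneousCore_le _ _
      (h (HomogeneousIdeal.mem_irrelevant_of_mem _ one_pos hX))
    simpa [mem_pointIdeal] using this

theorem mem_projPoint_iff {m : ℕ} {v : Fin m → ℂ} {hv : v ≠ 0} {g : MvPolynomial (Fin m) ℂ} {d : ℕ}
    (hg : g.IsHomogeneous d) : g ∈ (projPoint v hv).asHomogeneousIdeal ↔ eval v g = 0 :=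
  ⟨fun h => Ideal.toIdeal_homogeneousCore_le _ _ h,
    fun h => Ideal.mem_homogeneousCore_of_homogeneous_of_mem ⟨d, hg⟩ h⟩

theorem projPoint_rep_injective {m : ℕ} : Function.Injective
    fun p : Projectivization ℂ (Fin m → ℂ) => projPoint p.rep p.rep_nonzero := by
  intro p q h
  rw [← p.mk_rep, ← q.mk_rep, Projectivization.mk_eq_mk_iff']
  obtain ⟨i, hi⟩ := Function.ne_iff.1 q.rep_nonzero
  refine ⟨p.rep i / q.rep i, funext fun j => ?_⟩
  have hhom : (C (p.rep i) * X j - C (p.rep j) * X i : MvPolynomial (Fin m) ℂ).IsHomogeneous 1 :=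
    (isHomogeneous_C_mul_X _ _).sub (isHomogeneous_C_mul_X _ _)
  have h1 := (mem_projPoint_iff (hv := p.rep_nonzero) hhom).2 (by simp; ring)
  have h' : projPoint p.rep p.rep_nonzero = projPoint q.rep q.rep_nonzero := h
  rw [h', mem_projPoint_iff hhom] at h1
  simp only [map_sub, map_mul, eval_C, eval_X] at h1
  have hi' : q.rep i ≠ 0 := hi
  rw [Pi.smul_apply, smul_eq_mul]
  field_simp
  linear_combination h1

theorem isHomogeneous_eigenMinor {m : ℕ} {f : MvPolynomial (Fin m) ℂ} (hf : f.IsHomogeneous 3)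
    (i j : Fin m) : (X i * pderiv j f - X j * pderiv i f).IsHomogeneous 3 :=
  ((isHomogeneous_X _ i).mul hf.pderiv).sub ((isHomogeneous_X _ j).mul hf.pderiv)

theorem finite_regularEigenpoints {m : ℕ} {f : MvPolynomial (Fin m) ℂ} (hf : f.IsHomogeneous 3)
    (hdim : regularDim f ≤ 0) : (regularEigenpoints f).Finite := by
  have hfin : Finite (regularSpace f) := finite_of_topologicalKrullDim_nonpos hdim
  refine Set.Finite.of_finite_image (f := fun p : Projectivization ℂ (Fin m → ℂ) =>
    projPoint p.rep p.rep_nonzero) ((Set.toFinite (regularSpace f)).subset ?_)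
    projPoint_rep_injective.injOn
  rintro _ ⟨p, hp, rfl⟩
  obtain ⟨h, i, hi⟩ := mem_regularEigenpoints_iff.1 hp
  rw [regularSpace, eigenIdeal, irregularIdeal, ProjectiveSpectrum.zeroLocus_span,
    ProjectiveSpectrum.zeroLocus_span]
  constructor
  · rintro _ ⟨i, j, rfl⟩
    refine (mem_projPoint_iff (isHomogeneous_eigenMinor hf i j)).2 ?_
    simpa [sub_eq_zero] using h i j
  · exact fun h' => hi ((mem_projPoint_iff hf.pderiv).1 (h' ⟨i, rfl⟩))

/-- The equations of the fixed vectors of the gradient. -/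
noncomputable def fixedEquation {m : ℕ} (f : MvPolynomial (Fin m) ℂ) (i : Fin m) :
    MvPolynomial (Fin m) ℂ := pderiv i f - X i

theorem zeroLocus_fixedEquation {m : ℕ} (f : MvPolynomial (Fin m) ℂ) :
    zeroLocus ℂ (Ideal.span (Set.range (fixedEquation f))) = gradFixed f := by
  rw [zeroLocus_span]
  ext w
  simp [gradFixed, fixedEquation, sub_eq_zero, aeval_eq_eval]

theorem ncard_regularEigenpoints_le {m : ℕ} {f : MvPolynomial (Fin m) ℂ} (hf : f.IsHomogeneous 3)
    (hfin : (regularEigenpoints f).Finite) : (regularEigenpoints f).ncard ≤ 2 ^ m - 1 := by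
  have hcard := encard_gradFixed hf
  have hfix : (gradFixed f).Finite := by
    rw [← Set.encard_lt_top_iff, hcard]
    exact ENat.add_lt_top.2 ⟨hfin.encard_lt_top, ENat.natCast_lt_top 1⟩
  have hle : (gradFixed f).ncard ≤ 2 ^ m := by
    have hdeg : ∀ i, (fixedEquation f i).totalDegree ≤ 2 := fun i =>
      (totalDegree_sub _ _).trans (max_le hf.pderiv.totalDegree_le (by simp))
    have := ncard_zeroLocus_span_le (fixedEquation f) hdeg
      (by rwa [zeroLocus_fixedEquation])
    rwa [zeroLocus_fixedEquation, Fintype.card_fin] at this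
  rw [← hfix.cast_ncard_eq, ← hfin.cast_ncard_eq] at hcard
  have : (gradFixed f).ncard = (regularEigenpoints f).ncard + 1 := by exact_mod_cast hcard
  omega

/-! ### Reducedness from the Jacobian criterion -/

/-- First-order Taylor expansion at the point `p`. -/
theorem sub_taylor_mem_pointIdeal_sq {σ K : Type*} [Fintype σ] [Field K] (p : σ → K)
    (g : MvPolynomial σ K) :
    g - C (eval p g) - ∑ i, C (eval p (pderiv i g)) * (X i - C (p i)) ∈ pointIdeal p ^ 2 := by
  classical
  induction g using MvPolynomial.induction_on with
  | C a => simp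
  | add g h hg hh =>
    have := add_mem hg hh
    convert this using 1
    simp only [map_add, add_mul, Finset.sum_add_distrib]
    ring
  | mul_X g k hg =>
    have h1 : (g - C (eval p g)) * (X k - C (p k)) ∈ pointIdeal p ^ 2 := by
      rw [pow_two]
      exact Ideal.mul_mem_mul (by simp [mem_pointIdeal]) (X_sub_C_mem_pointIdeal p k)
    have := add_mem (Ideal.mul_mem_left _ (C (p k)) hg) h1
    convert this using 1
    have hs : ∑ i, C (eval p (pderiv i (g * X k))) * (X i - C (p i)) =
        C (p k) * ∑ i, C (eval p (pderiv i g)) * (X i - C (p i)) +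
          C (eval p g) * (X k - C (p k)) := by
      have : ∀ i, C (eval p (pderiv i (g * X k))) * (X i - C (p i)) =
          C (p k) * (C (eval p (pderiv i g)) * (X i - C (p i))) +
            if i = k then C (eval p g) * (X k - C (p k)) else 0 := by
        intro i
        rw [pderiv_mul]
        rcases eq_or_ne i k with rfl | hik
        · rw [pderiv_X_self, if_pos rfl]
          simp only [mul_one, map_mul, map_add, eval_X]
          ring
        · rw [pderiv_X_of_ne hik.symm, if_neg hik]
          simp only [mul_zero, add_zero, map_mul, eval_X]
          ring
      simp only [this, Finset.sum_add_distrib, Finset.mul_sum, Finset.sum_ite_eq',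
        Finset.mem_univ, if_true]
    rw [hs]
    simp only [map_mul, eval_X]
    ring

/-- If the Jacobian matrix of `g` at a common zero `p` is injective, the `g i` generate the maximal
ideal of `p` to first order. -/
theorem pointIdeal_le_span_sup_sq {σ K : Type*} [Fintype σ] [Field K]
    (g : σ → MvPolynomial σ K) (p : σ → K) (hp : ∀ i, eval p (g i) = 0)
    (hJ : ∀ u : σ → K, (∀ i, ∑ j, eval p (pderiv j (g i)) * u j = 0) → u = 0) :
    pointIdeal p ≤ Ideal.span (Set.range g) ⊔ pointIdeal p ^ 2 := by
  classical
  set Q := Ideal.span (Set.range g) ⊔ pointIdeal p ^ 2 with hQ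
  let M : Matrix σ σ K := Matrix.of fun i j => eval p (pderiv j (g i))
  have hM : IsUnit M := by
    rw [← Matrix.mulVec_injective_iff_isUnit]
    intro u v huv
    have : M.mulVec (u - v) = 0 := by rw [Matrix.mulVec_sub, huv, sub_self]
    exact sub_eq_zero.1 (hJ _ fun i => congrFun this i)
  obtain ⟨N, hN⟩ := hM.exists_left_inv
  have h1 : ∀ i, ∑ j, C (M i j) * (X j - C (p j)) ∈ Q := by
    intro i
    have h2 : pointIdeal p ^ 2 ≤ Q := le_sup_right
    have h3 := h2 (sub_taylor_mem_pointIdeal_sq p (g i))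
    have h4 : g i ∈ Q := (le_sup_left : Ideal.span (Set.range g) ≤ Q) (Ideal.subset_span ⟨i, rfl⟩)
    rw [hp i, C_0, sub_zero] at h3
    have h5 := sub_mem h4 h3
    rwa [sub_sub_cancel] at h5
  have h5 : ∀ k, X k - C (p k) ∈ Q := by
    intro k
    have h6 : X k - C (p k) = ∑ i, C (N k i) * ∑ j, C (M i j) * (X j - C (p j)) := by
      simp only [Finset.mul_sum]
      rw [Finset.sum_comm]
      simp only [← mul_assoc, ← Finset.sum_mul, ← C_mul, ← map_sum]
      have h7 : ∀ j, ∑ i, N k i * M i j = (1 : Matrix σ σ K) k j := fun j => by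
        rw [← hN, Matrix.mul_apply]
      simp [h7, Matrix.one_apply]
    rw [h6]
    exact Ideal.sum_mem _ fun i _ => Ideal.mul_mem_left _ _ (h1 i)
  intro q hq
  have h8 := (le_sup_right : pointIdeal p ^ 2 ≤ Q) (sub_taylor_mem_pointIdeal_sq p q)
  rw [mem_pointIdeal.1 hq, C_0, sub_zero] at h8
  have h9 : ∑ i, C (eval p (pderiv i q)) * (X i - C (p i)) ∈ Q :=
    Ideal.sum_mem _ fun i _ => Ideal.mul_mem_left _ _ (h5 i)
  simpa using add_mem h8 h9

theorem le_sup_pow_of_le_sup_sq {R : Type*} [CommRing R] {I M : Ideal R} (h : M ≤ I ⊔ M ^ 2)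
    (k : ℕ) : M ≤ I ⊔ M ^ k := by
  induction k with
  | zero => simp
  | succ k ih =>
    refine h.trans (sup_le le_sup_left ?_)
    calc M ^ 2 = M * M := pow_two M
      _ ≤ (I ⊔ M ^ k) * M := Ideal.mul_mono_left ih
      _ = I * M ⊔ M ^ (k + 1) := by rw [Ideal.sup_mul, pow_succ]
      _ ≤ I ⊔ M ^ (k + 1) := sup_le_sup_right Ideal.mul_le_left _

theorem prod_sup_le {R ι : Type*} [CommRing R] (I : Ideal R) (M : ι → Ideal R) (s : Finset ι) :
    ∏ i ∈ s, (I ⊔ M i) ≤ I ⊔ ∏ i ∈ s, M i := by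
  classical
  induction s using Finset.induction_on with
  | empty => simp
  | insert a s ha ih =>
    rw [Finset.prod_insert ha, Finset.prod_insert ha]
    calc (I ⊔ M a) * ∏ i ∈ s, (I ⊔ M i) ≤ (I ⊔ M a) * (I ⊔ ∏ i ∈ s, M i) := Ideal.mul_mono_right ih
      _ = (I ⊔ M a) * I ⊔ ((I * ∏ i ∈ s, M i) ⊔ (M a * ∏ i ∈ s, M i)) := by
        rw [Ideal.mul_sup, Ideal.sup_mul I (M a) (∏ i ∈ s, M i)]
      _ ≤ I ⊔ M a * ∏ i ∈ s, M i :=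
        sup_le (Ideal.mul_le_right.trans le_sup_left)
          (sup_le_sup_right Ideal.mul_le_left (M a * ∏ i ∈ s, M i))

/-- **Jacobian criterion.** A system with finitely many solutions, all of them nondegenerate,
generates a radical ideal. -/
theorem isRadical_span_of_jacobian {σ K : Type*} [Fintype σ] [Field K] [IsAlgClosed K]
    (g : σ → MvPolynomial σ K) (hfin : (zeroLocus K (Ideal.span (Set.range g))).Finite)
    (hJ : ∀ p ∈ zeroLocus K (Ideal.span (Set.range g)), ∀ u : σ → K,
      (∀ i, ∑ j, eval p (pderiv j (g i)) * u j = 0) → u = 0) :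
    (Ideal.span (Set.range g)).IsRadical := by
  classical
  set I := Ideal.span (Set.range g) with hI
  obtain ⟨r, hr⟩ := I.exists_radical_pow_le_of_fg (IsNoetherian.noetherian _)
  have hrad : I.radical = ∏ p ∈ hfin.toFinset, pointIdeal p := by
    rw [← vanishingIdeal_zeroLocus_eq_radical (K := K)]
    rw [Ideal.prod_eq_iInf_of_pairwise_isCoprime fun p _ q _ hpq => by
      simpa using isCoprime_pointIdeal_pow hpq 1]
    ext q
    change (∀ x ∈ zeroLocus K I, aeval x q = 0) ↔ _
    simp only [Ideal.mem_iInf, hfin.mem_toFinset, mem_pointIdeal, aeval_eq_eval]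
  have hm : ∀ p ∈ hfin.toFinset, pointIdeal p ≤ I ⊔ pointIdeal p ^ r := by
    intro p hp
    rw [hfin.mem_toFinset] at hp
    refine le_sup_pow_of_le_sup_sq (pointIdeal_le_span_sup_sq g p (fun i => ?_) (hJ p hp)) r
    rw [← aeval_eq_eval]
    exact hp _ (Ideal.subset_span ⟨i, rfl⟩)
  calc I.radical = ∏ p ∈ hfin.toFinset, pointIdeal p := hrad
    _ ≤ ∏ p ∈ hfin.toFinset, (I ⊔ pointIdeal p ^ r) := Finset.prod_le_prod' hm
    _ ≤ I ⊔ ∏ p ∈ hfin.toFinset, pointIdeal p ^ r := prod_sup_le _ _ _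
    _ ≤ I := by
      rw [Finset.prod_pow, ← hrad]
      exact sup_le le_rfl hr

theorem mem_saturation_span_iff {R ι : Type*} [CommRing R] [IsNoetherianRing R] {J : Ideal R}
    {F : ι → R} {h : R} :
    h ∈ saturation J (Ideal.span (Set.range F)) ↔ ∀ i, ∃ N, h * F i ^ N ∈ J := by
  constructor
  · rintro ⟨k, hk⟩ i
    exact ⟨k, hk _ (Ideal.pow_mem_pow (Ideal.subset_span (Set.mem_range_self i)) k)⟩
  · intro H
    -- The ideal quotient `J : h`.
    let Q : Ideal R := J.colon {h}
    have hle : Ideal.span (Set.range F) ≤ Q.radical := by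
      rw [Ideal.span_le]
      rintro _ ⟨i, rfl⟩
      obtain ⟨N, hN⟩ := H i
      exact ⟨N, Submodule.mem_colon_singleton.2 (by rwa [smul_eq_mul, mul_comm])⟩
    obtain ⟨k, hk⟩ := Ideal.exists_pow_le_of_le_radical_of_fg hle (IsNoetherian.noetherian _)
    refine ⟨k, fun x hx => ?_⟩
    have := Submodule.mem_colon_singleton.1 (hk hx)
    rwa [smul_eq_mul, mul_comm] at this

theorem mem_regularIdeal_iff {m : ℕ} {f h : MvPolynomial (Fin m) ℂ} :
    h ∈ regularIdeal f ↔ ∀ i, ∃ N, h * pderiv i f ^ N ∈ eigenIdeal f :=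
  mem_saturation_span_iff

theorem isHomogeneous_eigenIdeal {m : ℕ} {f : MvPolynomial (Fin m) ℂ} (hf : f.IsHomogeneous 3) :
    (eigenIdeal f).IsHomogeneous (homogeneousSubmodule (Fin m) ℂ) := by
  refine Ideal.homogeneous_span _ _ ?_
  rintro _ ⟨i, j, rfl⟩
  exact ⟨3, isHomogeneous_eigenMinor hf i j⟩

theorem isHomogeneous_regularIdeal {m : ℕ} {f : MvPolynomial (Fin m) ℂ} (hf : f.IsHomogeneous 3) :
    (regularIdeal f).IsHomogeneous (homogeneousSubmodule (Fin m) ℂ) := by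
  intro n h hh
  rw [mem_regularIdeal_iff] at hh ⊢
  intro i
  obtain ⟨N, hN⟩ := hh i
  refine ⟨N, ?_⟩
  have hF : pderiv i f ^ N ∈ homogeneousSubmodule (Fin m) ℂ (2 * N) := hf.pderiv.pow N
  rw [← DirectSum.coe_decompose_mul_add_of_right_mem _ hF]
  exact isHomogeneous_eigenIdeal hf _ hN

theorem eval_eq_zero_of_mem_eigenIdeal {m : ℕ} {f : MvPolynomial (Fin m) ℂ} {w : Fin m → ℂ}
    (hw : w ∈ gradFixed f) {g : MvPolynomial (Fin m) ℂ} (hg : g ∈ eigenIdeal f) :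
    eval w g = 0 := by
  refine eval_eq_zero_of_mem_span.2 ?_ g hg
  rintro _ ⟨i, j, rfl⟩
  simp [hw i, hw j, mul_comm]

/-- On the open set `∂f/∂x_i ≠ 0` of the eigenscheme, `x ↦ (x_i / (∂f/∂x_i)) x` is a map to the
scheme of fixed vectors of the gradient. Pulling back along it, a form `h` for which `x_i h` vanishes
on the scheme of fixed vectors vanishes on this open set. -/
theorem exists_mul_pow_mem_eigenIdeal {m : ℕ} {f : MvPolynomial (Fin m) ℂ} (hf : f.IsHomogeneous 3)
    {h : MvPolynomial (Fin m) ℂ} {d : ℕ} (hh : h.IsHomogeneous d) (i : Fin m)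
    (hmem : X i * h ∈ Ideal.span (Set.range (fixedEquation f))) :
    ∃ N, h * pderiv i f ^ N ∈ eigenIdeal f := by
  let q : MvPolynomial (Fin m) ℂ →+* MvPolynomial (Fin m) ℂ ⧸ eigenIdeal f := Ideal.Quotient.mk _
  let S := Localization.Away (q (pderiv i f))
  let φ : MvPolynomial (Fin m) ℂ →ₐ[ℂ] S :=
    (IsScalarTower.toAlgHom ℂ (MvPolynomial (Fin m) ℂ ⧸ eigenIdeal f) S).comp
      (Ideal.Quotient.mkₐ ℂ (eigenIdeal f))
  have hφ : ∀ g, φ g = algebraMap _ S (q g) := fun g => rfl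
  have hunit : IsUnit (φ (pderiv i f)) :=
    IsLocalization.map_units S (⟨q (pderiv i f), Submonoid.mem_powers _⟩ :
      Submonoid.powers (q (pderiv i f)))
  obtain ⟨v, hv⟩ := hunit.exists_right_inv
  set l : S := φ (X i) * v with hl
  have hlF : ∀ j, l * φ (pderiv j f) = φ (X j) := by
    intro j
    have h1 : q (X i * pderiv j f) = q (X j * pderiv i f) :=
      Ideal.Quotient.eq.2 (Ideal.subset_span ⟨i, j, rfl⟩)
    have h2 : φ (X i) * φ (pderiv j f) = φ (X j) * φ (pderiv i f) := by
      rw [← map_mul, ← map_mul, hφ, hφ, h1]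
    calc l * φ (pderiv j f) = (φ (X i) * φ (pderiv j f)) * v := by rw [hl]; ring
      _ = φ (X j) * (φ (pderiv i f) * v) := by rw [h2]; ring
      _ = φ (X j) := by rw [hv, mul_one]
  have hφX : ∀ g, φ g = aeval (fun j => φ (X j)) g := fun g => by
    rw [← comp_aeval_apply, aeval_X_left_apply]
  -- `l` is a unit, because `l ^ 2` divides the unit `φ (∂f/∂x_i)`.
  have hlunit : IsUnit l := by
    have h1 : φ (pderiv i f) = l ^ 2 * aeval (fun j => φ (pderiv j f)) (pderiv i f) := by
      rw [hφX (pderiv i f)]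
      have := aeval_mul_of_isHomogeneous hf.pderiv l (fun j => φ (pderiv j f)) (g := pderiv i f)
      simp only [hlF] at this
      exact this
    rw [h1] at hunit
    exact isUnit_of_mul_isUnit_left ((pow_two l) ▸ isUnit_of_mul_isUnit_left hunit)
  let ψ : MvPolynomial (Fin m) ℂ →ₐ[ℂ] S := aeval fun j => l * φ (X j)
  have hψ : ∀ {g : MvPolynomial (Fin m) ℂ} {e : ℕ}, g.IsHomogeneous e → ψ g = l ^ e * φ g := by
    intro g e hg
    rw [hφX g]
    exact aeval_mul_of_isHomogeneous hg l _
  have hker : Ideal.span (Set.range (fixedEquation f)) ≤ RingHom.ker ψ := by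
    rw [Ideal.span_le]
    rintro _ ⟨j, rfl⟩
    rw [SetLike.mem_coe, RingHom.mem_ker, fixedEquation, map_sub, hψ hf.pderiv,
      hψ (isHomogeneous_X _ j), ← hlF j]
    ring
  have h0 : φ h = 0 := by
    have h1 : ψ (X i * h) = 0 := hker hmem
    rw [map_mul, hψ hh, hψ (isHomogeneous_X _ i), ← hlF i] at h1
    have h2 : (l ^ 1 * (l * φ (pderiv i f)) * l ^ d) * φ h = 0 := by rw [← h1]; ring
    exact ((((hlunit.pow 1).mul (hlunit.mul hunit)).mul (hlunit.pow d)).mul_right_eq_zero).1 h2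
  rw [hφ, IsLocalization.map_eq_zero_iff (Submonoid.powers (q (pderiv i f))) S] at h0
  obtain ⟨⟨_, N, rfl⟩, hN⟩ := h0
  refine ⟨N, Ideal.Quotient.eq_zero_iff_mem.1 ?_⟩
  rw [map_mul, map_pow, mul_comm]
  exact hN

/-- If the scheme of fixed vectors of the gradient is reduced, then so is the regular eigenscheme. -/
theorem isRegReduced_of_isRadical {m : ℕ} {f : MvPolynomial (Fin m) ℂ} (hf : f.IsHomogeneous 3)
    (hrad : (Ideal.span (Set.range (fixedEquation f))).IsRadical) : IsRegReduced f := by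
  have hhom := isHomogeneous_regularIdeal hf
  -- It suffices to treat homogeneous elements of the radical.
  suffices H : ∀ (d : ℕ) (h : MvPolynomial (Fin m) ℂ), h.IsHomogeneous d →
      h ∈ (regularIdeal f).radical → h ∈ regularIdeal f by
    intro h hh
    rw [mem_iff_homogeneousComponent_mem hhom]
    exact fun n => H n _ (homogeneousComponent_isHomogeneous n h)
      (homogeneousComponent_mem_of_mem hhom.radical hh n)
  intro d h hh ⟨r, hr⟩
  rw [mem_regularIdeal_iff] at hr ⊢
  intro i
  refine exists_mul_pow_mem_eigenIdeal hf hh i (hrad ?_)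
  rw [← vanishingIdeal_zeroLocus_eq_radical (K := ℂ), zeroLocus_fixedEquation]
  intro w hw
  rw [aeval_eq_eval]
  change eval w (X i * h) = 0
  rw [map_mul, eval_X]
  by_cases hwi : w i = 0
  · rw [hwi, zero_mul]
  · obtain ⟨N, hN⟩ := hr i
    have h1 := eval_eq_zero_of_mem_eigenIdeal hw hN
    rw [map_mul, map_pow, map_pow, hw i] at h1
    rw [eq_zero_of_pow_eq_zero ((mul_eq_zero.1 h1).resolve_right (pow_ne_zero N hwi)), mul_zero]

/-- The fixed vectors of the gradient are nondegenerate: the Jacobian matrix of the equations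
`∇f(w) = w` is injective at each of them. -/
def NondegenerateFixed {m : ℕ} (f : MvPolynomial (Fin m) ℂ) : Prop :=
  ∀ w ∈ gradFixed f, ∀ u : Fin m → ℂ,
    (∀ i, ∑ j, eval w (pderiv j (pderiv i f)) * u j = u i) → u = 0

theorem isRegReduced_of_nondegenerateFixed {m : ℕ} {f : MvPolynomial (Fin m) ℂ}
    (hf : f.IsHomogeneous 3) (hfin : (gradFixed f).Finite) (hJ : NondegenerateFixed f) :
    IsRegReduced f := by
  classical
  refine isRegReduced_of_isRadical hf (isRadical_span_of_jacobian _ ?_ ?_) <;>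
    rw [zeroLocus_fixedEquation]
  · exact hfin
  · intro w hw u hu
    refine hJ w hw u fun i => ?_
    have := hu i
    simp only [fixedEquation, map_sub, pderiv_X, sub_mul, Finset.sum_sub_distrib] at this
    rw [sub_eq_zero] at this
    rw [this]
    simp [Pi.single_apply, apply_ite, ite_mul]

/-! ### Cubics with nondegenerate real fixed vectors -/

/-- The cubic `f` has exactly `s` vectors fixed by its gradient, all real and nondegenerate. -/
structure HasRealFixed {m : ℕ} (f : MvPolynomial (Fin m) ℂ) (s : ℕ) : Prop where
  isHomogeneous : f.IsHomogeneous 3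
  encard_eq : (gradFixed f).encard = s
  real : ∀ w ∈ gradFixed f, ∃ v : Fin m → ℝ, w = fun i => (v i : ℂ)
  nondegenerate : NondegenerateFixed f

theorem HasRealFixed.regularEigenpoints {m t : ℕ} {f : MvPolynomial (Fin m) ℂ}
    (h : HasRealFixed f (t + 1)) :
    IsRegReduced f ∧ (regularEigenpoints f).encard = t ∧
      ∀ p ∈ regularEigenpoints f, IsRealPoint p := by
  have hfin : (gradFixed f).Finite := by
    rw [← Set.encard_lt_top_iff, h.encard_eq]
    exact ENat.natCast_lt_top _
  refine ⟨isRegReduced_of_nondegenerateFixed h.isHomogeneous hfin h.nondegenerate, ?_, ?_⟩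
  · have h1 := encard_gradFixed h.isHomogeneous
    rw [h.encard_eq, Nat.cast_add, Nat.cast_one] at h1
    exact (ENat.add_left_injective_of_ne_top ENat.one_ne_top h1).symm
  · intro p hp
    obtain ⟨w, h0, hw, rfl⟩ := exists_gradFixed_of_mem_regularEigenpoints h.isHomogeneous hp
    obtain ⟨v, rfl⟩ := h.real w hw
    exact ⟨v, h0, rfl⟩

theorem HasRealFixed.ne_zero {m s : ℕ} {f : MvPolynomial (Fin m) ℂ}
    (h : HasRealFixed f s) (hs : 2 ≤ s) : f ≠ 0 := by
  rintro rfl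
  have h1 : gradFixed (0 : MvPolynomial (Fin m) ℂ) = {0} := by
    ext w
    simp [gradFixed, funext_iff, eq_comm]
  have h2 := h.encard_eq
  rw [h1, Set.encard_singleton] at h2
  have : (1 : ℕ) = s := by exact_mod_cast h2
  omega

/-- The orthogonal sum of two cubics, in disjoint sets of variables. -/
noncomputable def orthoSum {a b : ℕ} (f : MvPolynomial (Fin a) ℂ) (g : MvPolynomial (Fin b) ℂ) :
    MvPolynomial (Fin (a + b)) ℂ :=
  rename (Fin.castAdd b) f + rename (Fin.natAdd a) g

theorem pderiv_rename_of_notMem_range {σ τ : Type*} {k : σ → τ} {i : τ} (hi : i ∉ Set.range k)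
    (p : MvPolynomial σ ℂ) : pderiv i (rename k p) = 0 := by
  classical
  refine pderiv_eq_zero_of_notMem_vars fun h => hi ?_
  obtain ⟨j, -, rfl⟩ := Finset.mem_image.1 (vars_rename k p h)
  exact ⟨j, rfl⟩

theorem natAdd_notMem_range_castAdd {a b : ℕ} (i : Fin b) :
    Fin.natAdd a i ∉ Set.range (Fin.castAdd b : Fin a → Fin (a + b)) := by
  rintro ⟨j, hj⟩
  have := congrArg Fin.val hj
  simp only [Fin.val_castAdd, Fin.val_natAdd] at this
  omega

theorem castAdd_notMem_range_natAdd {a b : ℕ} (i : Fin a) :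
    Fin.castAdd b i ∉ Set.range (Fin.natAdd a : Fin b → Fin (a + b)) := by
  rintro ⟨j, hj⟩
  exact natAdd_notMem_range_castAdd j ⟨i, hj.symm⟩

theorem pderiv_castAdd_orthoSum {a b : ℕ} (f : MvPolynomial (Fin a) ℂ)
    (g : MvPolynomial (Fin b) ℂ) (i : Fin a) :
    pderiv (Fin.castAdd b i) (orthoSum f g) = rename (Fin.castAdd b) (pderiv i f) := by
  rw [orthoSum, map_add, pderiv_rename (Fin.castAdd_injective a b),
    pderiv_rename_of_notMem_range (castAdd_notMem_range_natAdd i), add_zero]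

theorem pderiv_natAdd_orthoSum {a b : ℕ} (f : MvPolynomial (Fin a) ℂ)
    (g : MvPolynomial (Fin b) ℂ) (i : Fin b) :
    pderiv (Fin.natAdd a i) (orthoSum f g) = rename (Fin.natAdd a) (pderiv i g) := by
  rw [orthoSum, map_add, pderiv_rename (Fin.natAdd_injective b a),
    pderiv_rename_of_notMem_range (natAdd_notMem_range_castAdd i), zero_add]

theorem mem_gradFixed_orthoSum {a b : ℕ} {f : MvPolynomial (Fin a) ℂ}
    {g : MvPolynomial (Fin b) ℂ} {w : Fin (a + b) → ℂ} :
    w ∈ gradFixed (orthoSum f g) ↔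
      w ∘ Fin.castAdd b ∈ gradFixed f ∧ w ∘ Fin.natAdd a ∈ gradFixed g := by
  simp only [gradFixed, Set.mem_ofPred_eq]
  constructor
  · intro h
    constructor <;> intro i
    · rw [← eval_rename, ← pderiv_castAdd_orthoSum f g, h]; rfl
    · rw [← eval_rename, ← pderiv_natAdd_orthoSum f g, h]; rfl
  · rintro ⟨h1, h2⟩ i
    refine Fin.addCases (fun i => ?_) (fun i => ?_) i
    · rw [pderiv_castAdd_orthoSum, eval_rename, h1]; rfl
    · rw [pderiv_natAdd_orthoSum, eval_rename, h2]; rfl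

theorem HasRealFixed.orthoSum {a b r s : ℕ} {f : MvPolynomial (Fin a) ℂ}
    {g : MvPolynomial (Fin b) ℂ} (hf : HasRealFixed f r) (hg : HasRealFixed g s) :
    HasRealFixed (orthoSum f g) (r * s) where
  isHomogeneous := hf.isHomogeneous.rename_isHomogeneous.add hg.isHomogeneous.rename_isHomogeneous
  encard_eq := by
    have : gradFixed (CubicEigen.orthoSum f g) =
        Fin.appendEquiv a b '' (gradFixed f ×ˢ gradFixed g) := by
      ext w
      rw [mem_gradFixed_orthoSum, Equiv.image_eq_preimage_symm]
      rfl
    rw [this, (Fin.appendEquiv a b).injective.encard_image, Set.encard_prod, hf.encard_eq,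
      hg.encard_eq, Nat.cast_mul]
  real := by
    intro w hw
    rw [mem_gradFixed_orthoSum] at hw
    obtain ⟨u, hu⟩ := hf.real _ hw.1
    obtain ⟨v, hv⟩ := hg.real _ hw.2
    refine ⟨Fin.append u v, funext fun i => ?_⟩
    refine Fin.addCases (fun i => ?_) (fun i => ?_) i
    · rw [Fin.append_left]; exact congrFun hu i
    · rw [Fin.append_right]; exact congrFun hv i
  nondegenerate := by
    intro w hw u hu
    rw [mem_gradFixed_orthoSum] at hw
    have h1 := hf.nondegenerate _ hw.1 (u ∘ Fin.castAdd b) fun i => by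
      have := hu (Fin.castAdd b i)
      rw [Fin.sum_univ_add, pderiv_castAdd_orthoSum] at this
      simpa [pderiv_rename (Fin.castAdd_injective a b), eval_rename,
        pderiv_rename_of_notMem_range (natAdd_notMem_range_castAdd _)] using this
    have h2 := hg.nondegenerate _ hw.2 (u ∘ Fin.natAdd a) fun i => by
      have := hu (Fin.natAdd a i)
      rw [Fin.sum_univ_add, pderiv_natAdd_orthoSum] at this
      simpa [pderiv_rename (Fin.natAdd_injective b a), eval_rename,
        pderiv_rename_of_notMem_range (castAdd_notMem_range_natAdd _)] using this
    funext i
    refine Fin.addCases (fun i => ?_) (fun i => ?_) i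
    · exact congrFun h1 i
    · exact congrFun h2 i

/-! ### Counting points whose coordinates are square roots of rational numbers -/

/-- The odd extension of the square root; it parametrizes real numbers with rational square by
rational numbers. -/
noncomputable def signedSqrt (r : ℝ) : ℝ := if 0 ≤ r then √r else -√(-r)

theorem signedSqrt_mul_abs (r : ℝ) : signedSqrt r * |signedSqrt r| = r := by
  unfold signedSqrt
  split_ifs with h
  · rw [abs_of_nonneg (Real.sqrt_nonneg _), Real.mul_self_sqrt h]
  · rw [abs_neg, abs_of_nonneg (Real.sqrt_nonneg _), neg_mul, Real.mul_self_sqrt (by linarith),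
      neg_neg]

theorem signedSqrt_injective : Function.Injective signedSqrt := fun r s h => by
  rw [← signedSqrt_mul_abs r, h, signedSqrt_mul_abs]

theorem sq_eq_iff_signedSqrt {z : ℂ} {r : ℝ} (hr : 0 ≤ r) :
    z ^ 2 = r ↔ z = signedSqrt r ∨ z = signedSqrt (-r) := by
  have h1 : signedSqrt r = √r := if_pos hr
  have h2 : signedSqrt (-r) = -√r := by
    rcases hr.eq_or_lt with rfl | h
    · simp [signedSqrt]
    · rw [signedSqrt, if_neg (by linarith), neg_neg]
  have h3 : (r : ℂ) = ((√r : ℝ) : ℂ) ^ 2 := by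
    rw [← Complex.ofReal_pow, Real.sq_sqrt hr]
  rw [h1, h2, h3, sq_eq_sq_iff_eq_or_eq_neg, Complex.ofReal_neg]

/-- The coordinates with index in `q` of a vector are replaced by their signed square roots. -/
noncomputable def rootVector {m : ℕ} (q : Finset (Fin m)) (v : Fin m → ℚ) (i : Fin m) : ℝ :=
  if i ∈ q then signedSqrt (v i) else v i

theorem rootVector_injective {m : ℕ} (q : Finset (Fin m)) :
    Function.Injective fun v : Fin m → ℚ => fun i => ((rootVector q v i : ℝ) : ℂ) := by
  intro v w h
  funext i
  have h1 : rootVector q v i = rootVector q w i := Complex.ofReal_injective (congrFun h i)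
  unfold rootVector at h1
  split_ifs at h1
  · exact_mod_cast signedSqrt_injective h1
  · exact_mod_cast h1

/-- All sign changes of the vectors in `T` in the coordinates with index in `q`. -/
def signChanges {m : ℕ} (q : Finset (Fin m)) (T : Finset (Fin m → ℚ)) : Finset (Fin m → ℚ) :=
  T.biUnion fun τ => Fintype.piFinset fun i => if i ∈ q then {τ i, -τ i} else {τ i}

/-- If the vectors fixed by the gradient are those for which the coordinates outside `q` and the
squares of the coordinates in `q` form one of the rational vectors in `T`, then they are real, and
their number is the number of sign changes of `T`. -/
theorem hasRealFixed_of_squares {m : ℕ} {f : MvPolynomial (Fin m) ℂ} (hf : f.IsHomogeneous 3)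
    (q : Finset (Fin m)) (T : Finset (Fin m → ℚ)) (hT : ∀ τ ∈ T, ∀ i, i ∈ q → 0 ≤ τ i)
    (hfix : ∀ w, w ∈ gradFixed f ↔ ∃ τ ∈ T, ∀ i, (if i ∈ q then w i ^ 2 else w i) = (τ i : ℂ))
    (hJ : NondegenerateFixed f) {s : ℕ} (hs : (signChanges q T).card = s) : HasRealFixed f s := by
  -- Choosing a square root of `τ i` amounts to choosing a sign for `τ i`.
  have himage : gradFixed f = (fun v : Fin m → ℚ => fun i => ((rootVector q v i : ℝ) : ℂ)) ''
      (signChanges q T : Set (Fin m → ℚ)) := by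
    ext w
    have key : ∀ τ ∈ T, ∀ i, (if i ∈ q then w i ^ 2 else w i) = (τ i : ℂ) ↔
        ∃ a ∈ (if i ∈ q then {τ i, -τ i} else {τ i} : Finset ℚ),
          ((if i ∈ q then signedSqrt a else a : ℝ) : ℂ) = w i := by
      intro τ hτ i
      by_cases hi : i ∈ q
      · have h0 : (0 : ℝ) ≤ (τ i : ℝ) := by exact_mod_cast hT τ hτ i hi
        have := sq_eq_iff_signedSqrt (z := w i) h0
        simp only [hi, if_true, Finset.mem_insert, Finset.mem_singleton, exists_eq_or_imp,
          exists_eq_left]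
        rw [show ((τ i : ℚ) : ℂ) = ((τ i : ℝ) : ℂ) by norm_cast, this]
        simp only [Rat.cast_neg, eq_comm]
      · simp [hi, eq_comm]
    rw [hfix]
    constructor
    · rintro ⟨τ, hτ, h⟩
      choose v hv hvw using fun i => (key τ hτ i).1 (h i)
      refine ⟨v, Finset.mem_coe.2 (Finset.mem_biUnion.2 ⟨τ, hτ, Fintype.mem_piFinset.2 hv⟩), ?_⟩
      funext i
      exact hvw i
    · rintro ⟨v, hv, rfl⟩
      obtain ⟨τ, hτ, hv⟩ := Finset.mem_biUnion.1 (Finset.mem_coe.1 hv)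
      exact ⟨τ, hτ, fun i => (key τ hτ i).2 ⟨v i, Fintype.mem_piFinset.1 hv i, rfl⟩⟩
  subst hs
  refine ⟨hf, ?_, ?_, hJ⟩
  · rw [himage, (rootVector_injective q).encard_image, Set.encard_coe_eq_coe_finsetCard]
  · rw [himage]
    rintro _ ⟨v, -, rfl⟩
    exact ⟨_, rfl⟩

/-! ### Explicit cubics -/

/-- The quaternary cubic `z³/3 + z²t + x²(az + bt) + y²(cz + dt)`, in the variables
`(x, y, z, t)`. The vectors fixed by its gradient split into four groups: those with `x = y = 0`, of
which there are three, those with `x ≠ 0 = y`, which lie on `az + bt = 1/2`, those with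
`y ≠ 0 = x`, which lie on `cz + dt = 1/2`, and those with `x, y ≠ 0`, for which `(z, t)` is the
intersection of these two lines. -/
noncomputable def quaternaryCubic (a b c d : ℂ) : MvPolynomial (Fin 4) ℂ :=
  C 3⁻¹ * X 2 ^ 3 + X 2 ^ 2 * X 3 + X 0 ^ 2 * (C a * X 2 + C b * X 3) +
    X 1 ^ 2 * (C c * X 2 + C d * X 3)

theorem isHomogeneous_quaternaryCubic (a b c d : ℂ) : (quaternaryCubic a b c d).IsHomogeneous 3 :=
  (((isHomogeneous_C_mul_X_pow _ _ _).add ((isHomogeneous_X_pow _ 2).mul (isHomogeneous_X _ _))).add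
    ((isHomogeneous_X_pow _ 2).mul
      ((isHomogeneous_C_mul_X _ _).add (isHomogeneous_C_mul_X _ _)))).add
    ((isHomogeneous_X_pow _ 2).mul
      ((isHomogeneous_C_mul_X _ _).add (isHomogeneous_C_mul_X _ _)))

theorem pderiv_quaternaryCubic (a b c d : ℂ) : ∀ i, pderiv i (quaternaryCubic a b c d) =
    ![C 2 * X 0 * (C a * X 2 + C b * X 3), C 2 * X 1 * (C c * X 2 + C d * X 3),
      X 2 ^ 2 + C 2 * X 2 * X 3 + C a * X 0 ^ 2 + C c * X 1 ^ 2,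
      X 2 ^ 2 + C b * X 0 ^ 2 + C d * X 1 ^ 2] i := by
  have h3 : (C 3⁻¹ : MvPolynomial (Fin 4) ℂ) * 3 = 1 := by
    rw [show (3 : MvPolynomial (Fin 4) ℂ) = C 3 from rfl, ← C_mul]; norm_num
  have h2 : (C 2 : MvPolynomial (Fin 4) ℂ) = 2 := rfl
  rw [Fin.forall_fin_succ, Fin.forall_fin_succ, Fin.forall_fin_succ, Fin.forall_fin_succ]
  simp [quaternaryCubic, pderiv_X, Pi.single_apply, h2]
  refine ⟨by ring, by ring, ?_, by ring⟩
  linear_combination X 2 ^ 2 * h3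

theorem mem_gradFixed_quaternaryCubic {a b c d : ℂ} {w : Fin 4 → ℂ} :
    w ∈ gradFixed (quaternaryCubic a b c d) ↔
      2 * w 0 * (a * w 2 + b * w 3) = w 0 ∧ 2 * w 1 * (c * w 2 + d * w 3) = w 1 ∧
      w 2 ^ 2 + 2 * w 2 * w 3 + a * w 0 ^ 2 + c * w 1 ^ 2 = w 2 ∧
      w 2 ^ 2 + b * w 0 ^ 2 + d * w 1 ^ 2 = w 3 := by
  simp only [gradFixed, Set.mem_ofPred_eq, pderiv_quaternaryCubic]
  simp [Fin.forall_fin_succ]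

/-- In the hypothesis, the four equations in `(x, y, z, t)` are the linearization of the equations of
`mem_gradFixed_quaternaryCubic` at `w`. -/
theorem nondegenerateFixed_quaternaryCubic {a b c d : ℂ}
    (h : ∀ w ∈ gradFixed (quaternaryCubic a b c d), ∀ x y z t : ℂ,
      2 * x * (a * w 2 + b * w 3) + 2 * w 0 * (a * z + b * t) = x →
      2 * y * (c * w 2 + d * w 3) + 2 * w 1 * (c * z + d * t) = y →
      2 * w 2 * z + 2 * z * w 3 + 2 * w 2 * t + 2 * a * w 0 * x + 2 * c * w 1 * y = z →
      2 * w 2 * z + 2 * b * w 0 * x + 2 * d * w 1 * y = t → x = 0 ∧ y = 0 ∧ z = 0 ∧ t = 0) :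
    NondegenerateFixed (quaternaryCubic a b c d) := by
  intro w hw u hu
  simp only [pderiv_quaternaryCubic] at hu
  simp [Fin.forall_fin_succ, Fin.sum_univ_four, pderiv_X] at hu
  obtain ⟨h0, h1, h3, h4⟩ := hu
  obtain ⟨e0, e1, e2, e3⟩ := h w hw (u 0) (u 1) (u 2) (u 3) (by linear_combination h0)
    (by linear_combination h1) (by linear_combination h3) (by linear_combination h4)
  funext i
  fin_cases i <;> assumption

/-- The four groups have `3`, `4`, `4` and `4` elements. -/
theorem hasRealFixed_fifteen : HasRealFixed (quaternaryCubic (-1) 1 0 (-1)) 15 := by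
  have hT : ∀ w, w ∈ gradFixed (quaternaryCubic (-1) 1 0 (-1)) ↔
      ∃ τ ∈ ({![0, 0, 0, 0], ![0, 0, 1 / 2, 1 / 4], ![0, 0, -1, 1], ![3 / 16, 0, -1 / 4, 1 / 4],
        ![3 / 4, 0, 1 / 2, 1], ![0, 1 / 2, 0, -1 / 2], ![0, 9 / 2, 2, -1 / 2],
        ![3, 9 / 2, -1, -1 / 2]} : Finset (Fin 4 → ℚ)),
        ∀ i, (if i ∈ ({0, 1} : Finset (Fin 4)) then w i ^ 2 else w i) = (τ i : ℂ) := by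
    intro w
    rw [mem_gradFixed_quaternaryCubic]
    simp [Fin.forall_fin_succ]
    constructor
    · rintro ⟨h0, h1, h2, h3⟩
      have e0 : w 0 = 0 ∨ w 3 = w 2 + 1 / 2 := by grind
      have e1 : w 1 = 0 ∨ w 3 = -1 / 2 := by grind
      rcases e0 with e0 | e0 <;> rcases e1 with e1 | e1
      · have : w 2 = 0 ∨ w 2 = 1 / 2 ∨ w 2 = -1 := by grind
        grind
      · have : w 2 = 0 ∨ w 2 = 2 := by grind
        grind
      · have : w 2 = -1 / 4 ∨ w 2 = 1 / 2 := by grind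
        grind
      · have : w 2 = -1 := by grind
        grind
    · rintro (h | h | h | h | h | h | h | h) <;> obtain ⟨h0, h1, h2, h3⟩ := h <;>
        refine ⟨?_, ?_, ?_, ?_⟩ <;> grind
  have hJ : NondegenerateFixed (quaternaryCubic (-1) 1 0 (-1)) := by
    refine nondegenerateFixed_quaternaryCubic fun w hw x y z t h0 h1 h2 h3 => ?_
    rw [hT] at hw
    simp [Fin.forall_fin_succ] at hw
    clear hT
    generalize w 0 = p at *
    generalize w 1 = q at *
    generalize w 2 = r at *
    generalize w 3 = s at *
    rcases hw with h | h | h | h | h | h | h | h <;> obtain ⟨e0, e1, rfl, rfl⟩ := h <;>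
        norm_num at h0 h1 h2 h3
    all_goals grind
  exact hasRealFixed_of_squares (isHomogeneous_quaternaryCubic _ _ _ _) {0, 1} _
    (by decide +kernel) hT hJ (by decide +kernel)

/-- The four groups have `3`, `4`, `2` and `4` elements: the line `z = -1/2` contains the singular
point at infinity of the binary cubic, so only one value of `(z, t)` occurs on it. -/
theorem hasRealFixed_thirteen : HasRealFixed (quaternaryCubic 0 (-1) (-1) 0) 13 := by
  have hT : ∀ w, w ∈ gradFixed (quaternaryCubic 0 (-1) (-1) 0) ↔
      ∃ τ ∈ ({![0, 0, 0, 0], ![0, 0, 1 / 2, 1 / 4], ![0, 0, -1, 1], ![1 / 2, 0, 0, -1 / 2],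
        ![9 / 2, 0, 2, -1 / 2], ![0, 1 / 2, -1 / 2, 1 / 4],
        ![3 / 4, 5 / 4, -1 / 2, -1 / 2]} : Finset (Fin 4 → ℚ)),
        ∀ i, (if i ∈ ({0, 1} : Finset (Fin 4)) then w i ^ 2 else w i) = (τ i : ℂ) := by
    intro w
    rw [mem_gradFixed_quaternaryCubic]
    simp [Fin.forall_fin_succ]
    constructor
    · rintro ⟨h0, h1, h2, h3⟩
      have e0 : w 0 = 0 ∨ w 3 = -1 / 2 := by grind
      have e1 : w 1 = 0 ∨ w 2 = -1 / 2 := by grind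
      rcases e0 with e0 | e0 <;> rcases e1 with e1 | e1
      · have : w 2 = 0 ∨ w 2 = 1 / 2 ∨ w 2 = -1 := by grind
        grind
      · grind
      · have : w 2 = 0 ∨ w 2 = 2 := by grind
        grind
      · grind
    · rintro (h | h | h | h | h | h | h) <;> obtain ⟨h0, h1, h2, h3⟩ := h <;>
        refine ⟨?_, ?_, ?_, ?_⟩ <;> grind
  have hJ : NondegenerateFixed (quaternaryCubic 0 (-1) (-1) 0) := by
    refine nondegenerateFixed_quaternaryCubic fun w hw x y z t h0 h1 h2 h3 => ?_
    rw [hT] at hw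
    simp [Fin.forall_fin_succ] at hw
    clear hT
    generalize w 0 = p at *
    generalize w 1 = q at *
    generalize w 2 = r at *
    generalize w 3 = s at *
    rcases hw with h | h | h | h | h | h | h <;> obtain ⟨e0, e1, rfl, rfl⟩ := h <;>
        norm_num at h0 h1 h2 h3
    all_goals grind
  exact hasRealFixed_of_squares (isHomogeneous_quaternaryCubic _ _ _ _) {0, 1} _
    (by decide +kernel) hT hJ (by decide +kernel)

/-- The four groups have `3`, `4`, `4` and `0` elements: the lines `t = -1/2` and `t = -1/4` do not
meet. -/
theorem hasRealFixed_eleven : HasRealFixed (quaternaryCubic 0 (-1) 0 (-2)) 11 := by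
  have hT : ∀ w, w ∈ gradFixed (quaternaryCubic 0 (-1) 0 (-2)) ↔
      ∃ τ ∈ ({![0, 0, 0, 0], ![0, 0, 1 / 2, 1 / 4], ![0, 0, -1, 1], ![1 / 2, 0, 0, -1 / 2],
        ![9 / 2, 0, 2, -1 / 2], ![0, 1 / 8, 0, -1 / 4],
        ![0, 5 / 4, 3 / 2, -1 / 4]} : Finset (Fin 4 → ℚ)),
        ∀ i, (if i ∈ ({0, 1} : Finset (Fin 4)) then w i ^ 2 else w i) = (τ i : ℂ) := by
    intro w
    rw [mem_gradFixed_quaternaryCubic]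
    simp [Fin.forall_fin_succ]
    constructor
    · rintro ⟨h0, h1, h2, h3⟩
      have e0 : w 0 = 0 ∨ w 3 = -1 / 2 := by grind
      have e1 : w 1 = 0 ∨ w 3 = -1 / 4 := by grind
      rcases e0 with e0 | e0 <;> rcases e1 with e1 | e1
      · have : w 2 = 0 ∨ w 2 = 1 / 2 ∨ w 2 = -1 := by grind
        grind
      · have : w 2 = 0 ∨ w 2 = 3 / 2 := by grind
        grind
      · have : w 2 = 0 ∨ w 2 = 2 := by grind
        grind
      · grind
    · rintro (h | h | h | h | h | h | h) <;> obtain ⟨h0, h1, h2, h3⟩ := h <;>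
        refine ⟨?_, ?_, ?_, ?_⟩ <;> grind
  have hJ : NondegenerateFixed (quaternaryCubic 0 (-1) 0 (-2)) := by
    refine nondegenerateFixed_quaternaryCubic fun w hw x y z t h0 h1 h2 h3 => ?_
    rw [hT] at hw
    simp [Fin.forall_fin_succ] at hw
    clear hT
    generalize w 0 = p at *
    generalize w 1 = q at *
    generalize w 2 = r at *
    generalize w 3 = s at *
    rcases hw with h | h | h | h | h | h | h <;> obtain ⟨e0, e1, rfl, rfl⟩ := h <;>
        norm_num at h0 h1 h2 h3
    all_goals grind
  exact hasRealFixed_of_squares (isHomogeneous_quaternaryCubic _ _ _ _) {0, 1} _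
    (by decide +kernel) hT hJ (by decide +kernel)

/-- The ternary cubic `z³/3 + z²t + x²(az + bt)`, in the variables `(x, z, t)`. -/
noncomputable def ternaryCubic (a b : ℂ) : MvPolynomial (Fin 3) ℂ :=
  C 3⁻¹ * X 1 ^ 3 + X 1 ^ 2 * X 2 + X 0 ^ 2 * (C a * X 1 + C b * X 2)

theorem isHomogeneous_ternaryCubic (a b : ℂ) : (ternaryCubic a b).IsHomogeneous 3 :=
  ((isHomogeneous_C_mul_X_pow _ _ _).add ((isHomogeneous_X_pow _ 2).mul (isHomogeneous_X _ _))).add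
    ((isHomogeneous_X_pow _ 2).mul ((isHomogeneous_C_mul_X _ _).add (isHomogeneous_C_mul_X _ _)))

theorem pderiv_ternaryCubic (a b : ℂ) : ∀ i, pderiv i (ternaryCubic a b) =
    ![C 2 * X 0 * (C a * X 1 + C b * X 2), X 1 ^ 2 + C 2 * X 1 * X 2 + C a * X 0 ^ 2,
      X 1 ^ 2 + C b * X 0 ^ 2] i := by
  have h3 : (C 3⁻¹ : MvPolynomial (Fin 3) ℂ) * 3 = 1 := by
    rw [show (3 : MvPolynomial (Fin 3) ℂ) = C 3 from rfl, ← C_mul]; norm_num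
  have h2 : (C 2 : MvPolynomial (Fin 3) ℂ) = 2 := rfl
  rw [Fin.forall_fin_succ, Fin.forall_fin_succ, Fin.forall_fin_succ]
  simp [ternaryCubic, pderiv_X, Pi.single_apply, h2]
  refine ⟨by ring, ?_, by ring⟩
  linear_combination X 1 ^ 2 * h3

theorem mem_gradFixed_ternaryCubic {a b : ℂ} {w : Fin 3 → ℂ} :
    w ∈ gradFixed (ternaryCubic a b) ↔
      2 * w 0 * (a * w 1 + b * w 2) = w 0 ∧
      w 1 ^ 2 + 2 * w 1 * w 2 + a * w 0 ^ 2 = w 1 ∧ w 1 ^ 2 + b * w 0 ^ 2 = w 2 := by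
  simp only [gradFixed, Set.mem_ofPred_eq, pderiv_ternaryCubic]
  simp [Fin.forall_fin_succ]

theorem nondegenerateFixed_ternaryCubic {a b : ℂ}
    (h : ∀ w ∈ gradFixed (ternaryCubic a b), ∀ x z t : ℂ,
      2 * x * (a * w 1 + b * w 2) + 2 * w 0 * (a * z + b * t) = x →
      2 * w 1 * z + 2 * z * w 2 + 2 * w 1 * t + 2 * a * w 0 * x = z →
      2 * w 1 * z + 2 * b * w 0 * x = t → x = 0 ∧ z = 0 ∧ t = 0) :
    NondegenerateFixed (ternaryCubic a b) := by
  intro w hw u hu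
  simp only [pderiv_ternaryCubic] at hu
  simp [Fin.forall_fin_succ, Fin.sum_univ_three, pderiv_X] at hu
  obtain ⟨h0, h1, h2⟩ := hu
  obtain ⟨e0, e1, e2⟩ := h w hw (u 0) (u 1) (u 2) (by linear_combination h0)
    (by linear_combination h1) (by linear_combination h2)
  funext i
  fin_cases i <;> assumption

theorem hasRealFixed_seven : HasRealFixed (ternaryCubic 0 (-1)) 7 := by
  have hT : ∀ w, w ∈ gradFixed (ternaryCubic 0 (-1)) ↔
      ∃ τ ∈ ({![0, 0, 0], ![0, 1 / 2, 1 / 4], ![0, -1, 1], ![1 / 2, 0, -1 / 2],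
        ![9 / 2, 2, -1 / 2]} : Finset (Fin 3 → ℚ)),
        ∀ i, (if i ∈ ({0} : Finset (Fin 3)) then w i ^ 2 else w i) = (τ i : ℂ) := by
    intro w
    rw [mem_gradFixed_ternaryCubic]
    simp [Fin.forall_fin_succ]
    constructor
    · rintro ⟨h0, h1, h2⟩
      have e0 : w 0 = 0 ∨ w 2 = -1 / 2 := by grind
      rcases e0 with e0 | e0
      · have : w 1 = 0 ∨ w 1 = 1 / 2 ∨ w 1 = -1 := by grind
        grind
      · have : w 1 = 0 ∨ w 1 = 2 := by grind
        grind
    · rintro (h | h | h | h | h) <;> obtain ⟨h0, h1, h2⟩ := h <;>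
        refine ⟨?_, ?_, ?_⟩ <;> grind
  have hJ : NondegenerateFixed (ternaryCubic 0 (-1)) := by
    refine nondegenerateFixed_ternaryCubic fun w hw x z t h0 h1 h2 => ?_
    rw [hT] at hw
    simp [Fin.forall_fin_succ] at hw
    clear hT
    generalize w 0 = p at *
    generalize w 1 = q at *
    generalize w 2 = r at *
    rcases hw with h | h | h | h | h <;> obtain ⟨e0, rfl, rfl⟩ := h <;>
        norm_num at h0 h1 h2
    all_goals grind
  exact hasRealFixed_of_squares (isHomogeneous_ternaryCubic _ _) {0} _ (by decide +kernel) hT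
    hJ (by decide +kernel)

theorem hasRealFixed_five : HasRealFixed (ternaryCubic (-1) 0) 5 := by
  have hT : ∀ w, w ∈ gradFixed (ternaryCubic (-1) 0) ↔
      ∃ τ ∈ ({![0, 0, 0], ![0, 1 / 2, 1 / 4], ![0, -1, 1],
        ![1 / 2, -1 / 2, 1 / 4]} : Finset (Fin 3 → ℚ)),
        ∀ i, (if i ∈ ({0} : Finset (Fin 3)) then w i ^ 2 else w i) = (τ i : ℂ) := by
    intro w
    rw [mem_gradFixed_ternaryCubic]
    simp [Fin.forall_fin_succ]
    constructor
    · rintro ⟨h0, h1, h2⟩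
      have e0 : w 0 = 0 ∨ w 1 = -1 / 2 := by grind
      rcases e0 with e0 | e0
      · have : w 1 = 0 ∨ w 1 = 1 / 2 ∨ w 1 = -1 := by grind
        grind
      · grind
    · rintro (h | h | h | h) <;> obtain ⟨h0, h1, h2⟩ := h <;>
        refine ⟨?_, ?_, ?_⟩ <;> grind
  have hJ : NondegenerateFixed (ternaryCubic (-1) 0) := by
    refine nondegenerateFixed_ternaryCubic fun w hw x z t h0 h1 h2 => ?_
    rw [hT] at hw
    simp [Fin.forall_fin_succ] at hw
    clear hT
    generalize w 0 = p at *
    generalize w 1 = q at *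
    generalize w 2 = r at *
    rcases hw with h | h | h | h <;> obtain ⟨e0, rfl, rfl⟩ := h <;>
        norm_num at h0 h1 h2
    all_goals grind
  exact hasRealFixed_of_squares (isHomogeneous_ternaryCubic _ _) {0} _ (by decide +kernel) hT
    hJ (by decide +kernel)

/-- The binary cubic `z³/3 + z²t`, in the variables `(z, t)`. -/
noncomputable def binaryCubic : MvPolynomial (Fin 2) ℂ := C 3⁻¹ * X 0 ^ 3 + X 0 ^ 2 * X 1

theorem isHomogeneous_binaryCubic : binaryCubic.IsHomogeneous 3 :=
  (isHomogeneous_C_mul_X_pow _ _ _).add ((isHomogeneous_X_pow _ 2).mul (isHomogeneous_X _ _))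

theorem pderiv_binaryCubic : ∀ i, pderiv i binaryCubic =
    ![X 0 ^ 2 + C 2 * X 0 * X 1, X 0 ^ 2] i := by
  have h3 : (C 3⁻¹ : MvPolynomial (Fin 2) ℂ) * 3 = 1 := by
    rw [show (3 : MvPolynomial (Fin 2) ℂ) = C 3 from rfl, ← C_mul]; norm_num
  have h2 : (C 2 : MvPolynomial (Fin 2) ℂ) = 2 := rfl
  rw [Fin.forall_fin_succ, Fin.forall_fin_succ]
  simp [binaryCubic, pderiv_X, Pi.single_apply, h2]
  linear_combination X 0 ^ 2 * h3

theorem mem_gradFixed_binaryCubic {w : Fin 2 → ℂ} :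
    w ∈ gradFixed binaryCubic ↔ w 0 ^ 2 + 2 * w 0 * w 1 = w 0 ∧ w 0 ^ 2 = w 1 := by
  simp only [gradFixed, Set.mem_ofPred_eq, pderiv_binaryCubic]
  simp [Fin.forall_fin_succ]

theorem nondegenerateFixed_binaryCubic_of
    (h : ∀ w ∈ gradFixed binaryCubic, ∀ z t : ℂ,
      2 * w 0 * z + 2 * z * w 1 + 2 * w 0 * t = z → 2 * w 0 * z = t → z = 0 ∧ t = 0) :
    NondegenerateFixed binaryCubic := by
  intro w hw u hu
  simp only [pderiv_binaryCubic] at hu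
  simp [Fin.forall_fin_succ, Fin.sum_univ_two, pderiv_X] at hu
  obtain ⟨h0, h1⟩ := hu
  obtain ⟨e0, e1⟩ := h w hw (u 0) (u 1) (by linear_combination h0) (by linear_combination h1)
  funext i
  fin_cases i <;> assumption

theorem hasRealFixed_three : HasRealFixed binaryCubic 3 := by
  have hT : ∀ w, w ∈ gradFixed binaryCubic ↔
      ∃ τ ∈ ({![0, 0], ![1 / 2, 1 / 4], ![-1, 1]} : Finset (Fin 2 → ℚ)),
        ∀ i, (if i ∈ (∅ : Finset (Fin 2)) then w i ^ 2 else w i) = (τ i : ℂ) := by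
    intro w
    rw [mem_gradFixed_binaryCubic]
    simp [Fin.forall_fin_succ]
    constructor
    · rintro ⟨h0, h1⟩
      have : w 0 = 0 ∨ w 0 = 1 / 2 ∨ w 0 = -1 := by grind
      grind
    · rintro (h | h | h) <;> obtain ⟨h0, h1⟩ := h <;>
        refine ⟨?_, ?_⟩ <;> grind
  have hJ : NondegenerateFixed binaryCubic := by
    refine nondegenerateFixed_binaryCubic_of fun w hw z t h0 h1 => ?_
    rw [hT] at hw
    simp [Fin.forall_fin_succ] at hw
    clear hT
    generalize w 0 = p at *
    generalize w 1 = q at *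
    rcases hw with h | h | h <;> obtain ⟨rfl, rfl⟩ := h <;>
        norm_num at h0 h1
    all_goals grind
  exact hasRealFixed_of_squares isHomogeneous_binaryCubic ∅ _ (by decide +kernel) hT
    hJ (by decide +kernel)

theorem hasRealFixed_zero : HasRealFixed (0 : MvPolynomial (Fin 1) ℂ) 1 := by
  refine hasRealFixed_of_squares (isHomogeneous_zero _ _ _) ∅ {![0]} (by decide +kernel) ?_ ?_
    (by decide +kernel)
  · intro w
    simp [gradFixed, eq_comm]
  · intro w _ u hu
    funext i
    simpa using (hu i).symm

theorem hasRealFixed_two : HasRealFixed (C 3⁻¹ * X 0 ^ 3 : MvPolynomial (Fin 1) ℂ) 2 := by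
  have hd : ∀ i, pderiv i (C 3⁻¹ * X 0 ^ 3 : MvPolynomial (Fin 1) ℂ) = X 0 ^ 2 := by
    have h3 : (C 3⁻¹ : MvPolynomial (Fin 1) ℂ) * 3 = 1 := by
      rw [show (3 : MvPolynomial (Fin 1) ℂ) = C 3 from rfl, ← C_mul]; norm_num
    rw [Fin.forall_fin_one]
    simp
    linear_combination X 0 ^ 2 * h3
  have hw : ∀ w, w ∈ gradFixed (C 3⁻¹ * X 0 ^ 3 : MvPolynomial (Fin 1) ℂ) ↔
      w 0 = 0 ∨ w 0 = 1 := by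
    intro w
    simp only [gradFixed, Set.mem_ofPred_eq, hd, Fin.forall_fin_one]
    simp
    grind
  refine hasRealFixed_of_squares (isHomogeneous_C_mul_X_pow _ _ _) ∅ {![0], ![1]}
    (by decide +kernel) ?_ ?_ (by decide +kernel)
  · intro w
    rw [hw]
    simp
  · intro w h u hu
    rw [hw] at h
    simp only [hd] at hu
    simp at hu
    funext i
    fin_cases i
    change u 0 = 0
    grind

/-- The cube of an isotropic linear form: its gradient takes values in the isotropic line where it
vanishes, so it fixes no nonzero vector. -/
theorem hasRealFixed_isotropicCube (k : ℕ) :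
    HasRealFixed ((X 0 + C Complex.I * X 1) ^ 3 : MvPolynomial (Fin (k + 2)) ℂ) 1 := by
  set f : MvPolynomial (Fin (k + 2)) ℂ := (X 0 + C Complex.I * X 1) ^ 3 with hfdef
  have hf : f.IsHomogeneous 3 := by
    simpa using ((isHomogeneous_X ℂ (0 : Fin (k + 2))).add
      (isHomogeneous_C_mul_X Complex.I (1 : Fin (k + 2)))).pow 3
  have h01 : (1 : Fin (k + 2)) ≠ 0 := by simp
  have hd : ∀ i, pderiv i f = C 3 * (X 0 + C Complex.I * X 1) ^ 2 *
      (pderiv i (X 0) + C Complex.I * pderiv i (X 1)) := by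
    intro i
    rw [hfdef, pderiv_pow, map_add, pderiv_C_mul]
    rfl
  have hfix : gradFixed f = {0} := by
    refine Set.eq_singleton_iff_unique_mem.2 ⟨zero_mem_gradFixed hf, fun w hw => ?_⟩
    have hw' : ∀ i, eval w (pderiv i f) = w i := hw
    simp only [hd, map_mul, map_add, eval_C, map_pow, eval_X] at hw'
    have e0 := hw' 0
    have e1 := hw' 1
    rw [pderiv_X_self, pderiv_X_of_ne h01] at e0
    rw [pderiv_X_self, pderiv_X_of_ne h01.symm] at e1
    simp only [map_one, map_zero, mul_zero, add_zero, mul_one, zero_add] at e0 e1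
    have hs : w 0 + Complex.I * w 1 = 0 := by
      linear_combination -e0 - Complex.I * e1 +
        3 * (w 0 + Complex.I * w 1) ^ 2 * Complex.I_mul_I
    funext i
    rw [← hw' i, hs]
    simp
  refine ⟨hf, by rw [hfix, Set.encard_singleton]; rfl, fun w hw => ⟨0, ?_⟩, ?_⟩
  · rw [hfix] at hw
    rw [Set.mem_singleton_iff.1 hw]
    ext
    simp
  · intro w hw u hu
    rw [hfix, Set.mem_singleton_iff] at hw
    subst hw
    funext i
    rw [← hu i]
    refine Finset.sum_eq_zero fun j _ => ?_
    have := eval_smul_of_isHomogeneous ((hf.pderiv (i := i)).pderiv (i := j)) 0 0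
    simp only [zero_smul] at this
    rw [this]
    simp

theorem isotropicCube_ne_zero (k : ℕ) :
    ((X 0 + C Complex.I * X 1) ^ 3 : MvPolynomial (Fin (k + 2)) ℂ) ≠ 0 := by
  intro h
  have := congrArg (eval (Pi.single 0 1)) h
  simp at this

/-! ### Attained numbers of points -/

/-- In `m` variables, some cubic has exactly `s` vectors fixed by its gradient, all real and
nondegenerate. -/
def Attained (m s : ℕ) : Prop := ∃ f : MvPolynomial (Fin m) ℂ, HasRealFixed f s

theorem Attained.mul {a b r s : ℕ} (hr : Attained a r) (hs : Attained b s) :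
    Attained (a + b) (r * s) :=
  ⟨_, hr.choose_spec.orthoSum hs.choose_spec⟩

theorem attained_one_one : Attained 1 1 := ⟨_, hasRealFixed_zero⟩

theorem attained_one_two : Attained 1 2 := ⟨_, hasRealFixed_two⟩

theorem attained_two {s : ℕ} (h1 : 1 ≤ s) (h4 : s ≤ 4) : Attained 2 s := by
  interval_cases s
  · exact attained_one_one.mul attained_one_one
  · exact attained_one_two.mul attained_one_one
  · exact ⟨_, hasRealFixed_three⟩
  · exact attained_one_two.mul attained_one_two

theorem attained_three {s : ℕ} (h1 : 1 ≤ s) (h8 : s ≤ 8) : Attained 3 s := by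
  by_cases h4 : s ≤ 4
  · simpa using (attained_two h1 h4).mul attained_one_one
  · have h5 : 5 ≤ s := by omega
    clear h1 h4
    interval_cases s
    · exact ⟨_, hasRealFixed_five⟩
    · exact (attained_two (s := 3) (by norm_num) (by norm_num)).mul attained_one_two
    · exact ⟨_, hasRealFixed_seven⟩
    · exact (attained_two (s := 4) (by norm_num) (by norm_num)).mul attained_one_two

/-- Numbers up to `8`, even numbers and `9` come from orthogonal sums; `11`, `13` and `15` need
genuinely quaternary cubics. -/
theorem attained_four {s : ℕ} (h1 : 1 ≤ s) (h16 : s ≤ 16) : Attained 4 s := by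
  by_cases h8 : s ≤ 8
  · simpa using (attained_three h1 h8).mul attained_one_one
  · obtain ⟨r, rfl | rfl⟩ := s.even_or_odd'
    · rw [mul_comm]
      exact (attained_three (s := r) (by omega) (by omega)).mul attained_one_two
    · obtain rfl | rfl | rfl | rfl : r = 4 ∨ r = 5 ∨ r = 6 ∨ r = 7 := by omega
      · exact (attained_two (s := 3) (by norm_num) (by norm_num)).mul
          (attained_two (s := 3) (by norm_num) (by norm_num))
      · exact ⟨_, hasRealFixed_eleven⟩
      · exact ⟨_, hasRealFixed_thirteen⟩
      · exact ⟨_, hasRealFixed_fifteen⟩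

theorem exists_cubic_of_attained {k t : ℕ} (h : 1 ≤ t → Attained (k + 2) (t + 1)) :
    ∃ f : MvPolynomial (Fin (k + 2)) ℂ, f.IsHomogeneous 3 ∧ f ≠ 0 ∧ IsRegReduced f ∧
      (regularEigenpoints f).encard = t ∧ ∀ p ∈ regularEigenpoints f, IsRealPoint p := by
  obtain rfl | ht := Nat.eq_zero_or_pos t
  · have hf := hasRealFixed_isotropicCube k
    exact ⟨_, hf.isHomogeneous, isotropicCube_ne_zero k, hf.regularEigenpoints⟩
  · obtain ⟨f, hf⟩ := h ht
    exact ⟨f, hf.isHomogeneous, hf.ne_zero (by omega), hf.regularEigenpoints⟩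

end CubicEigen

theorem mainTheorem3 :
    (∀ (n : ℕ) (f : MvPolynomial (Fin (n + 1)) ℂ), f.IsHomogeneous 3 →
      CubicEigen.regularDim f ≤ 0 →
      (CubicEigen.regularEigenpoints f).Finite ∧
        (CubicEigen.regularEigenpoints f).ncard ≤ 2 ^ (n + 1) - 1) ∧
    (∀ t : ℕ, t ≤ 7 → ∃ f : MvPolynomial (Fin 3) ℂ, f.IsHomogeneous 3 ∧ f ≠ 0 ∧
      CubicEigen.IsRegReduced f ∧
      (CubicEigen.regularEigenpoints f).encard = t ∧
      ∀ p ∈ CubicEigen.regularEigenpoints f, CubicEigen.IsRealPoint p) ∧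
    (∀ t : ℕ, t ≤ 15 → ∃ f : MvPolynomial (Fin 4) ℂ, f.IsHomogeneous 3 ∧ f ≠ 0 ∧
      CubicEigen.IsRegReduced f ∧
      (CubicEigen.regularEigenpoints f).encard = t ∧
      ∀ p ∈ CubicEigen.regularEigenpoints f, CubicEigen.IsRealPoint p) := by
  refine ⟨fun n f hf hdim => ?_, fun t ht => ?_, fun t ht => ?_⟩
  · have hfin := CubicEigen.finite_regularEigenpoints hf hdim
    exact ⟨hfin, CubicEigen.ncard_regularEigenpoints_le hf hfin⟩
  · exact CubicEigen.exists_cubic_of_attained fun h =>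
      CubicEigen.attained_three (by omega) (by omega)
  · exact CubicEigen.exists_cubic_of_attained fun h =>
      CubicEigen.attained_four (by omega) (by omega)
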